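/- Let $k$ be a field of characteristic different from $2$, let $q \in k^\times$ be a scalar that is not a root of unity, and let $\delta := -(q - q^{-1})$. The odd Temperley–Lieb supercategory $\mathcal{STL}(\delta)$ is the $k$-linear strict monoidal supercategory with one generating object $\cdot$, whose $n$-fold tensor power is denoted by $n$, and two odd generating morphisms $\cup : 0 \to 2$ and $\cap : 2 \to 0$, subject to the relations $$(\cap \otimes 1) \circ (1 \otimes \cup) = 1, \qquad (1 \otimes \cap) \circ (\cup \otimes 1) = -1, \qquad \cap \circ \cup = \delta,$$ where $1$ in the first two relations is the identity morphism of the generating object. (So tensor products of homogeneous morphisms compose by the super interchange law $(f \otimes g) \circ (h \otimes l) = (-1)^{|g||h|} (f \circ h) \otimes (g \circ l)$.) A crossingless matching from $m$ points to $n$ points is a planar string diagram built from vertical strands, cups and caps, with $m$ end points on the bottom boundary and $n$ on the top boundary, without crossings and without closed loops; it defines a morphism $m \to n$ in $\mathcal{STL}(\delta)$. Two crossingless matchings are isotopic if they are related by planar isotopy relative to the boundary. Then for all $m, n \geq 0$, any set of representatives for the isotopy classes of crossingless matchings from $m$ points to $n$ points defines a basis of the vector space $\operatorname{Hom}_{\mathcal{STL}(\delta)}(m,n)$.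 -/

import Mathlib

universe u v w

/-- Transport of an element of a two-variable family along equalities of the indices. -/
def homCast {ι : Type u} {H : ι → ι → Type v} {a a' b b' : ι} (ha : a = a') (hb : b = b')
    (f : H a b) : H a' b' := ha ▸ hb ▸ f

theorem heq_homCast {ι : Type u} {H : ι → ι → Type v} {a a' b b' : ι} (ha : a = a')
    (hb : b = b') (f : H a b) : HEq f (homCast ha hb f) := by
  subst ha; subst hb; exact HEq.rfl

/-- A strict monoidal supercategory over `k`. The tensor product of objects is written
additively, so `0` is the unit object. `homog X Y 0` and `homog X Y 1` are the even and the odd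
parts of the superspace `Hom X Y`; `comp f g` is `f ∘ g`. Strictness is the associativity
and unitality of the tensor product, on objects and on morphisms. -/
structure StrictMonoidalSupercategory (k : Type w) [Field k] where
  Obj : Type u
  [objMonoid : AddMonoid Obj]
  Hom : Obj → Obj → Type v
  [homGroup : ∀ X Y, AddCommGroup (Hom X Y)]
  [homModule : ∀ X Y, Module k (Hom X Y)]
  homog : ∀ X Y, ZMod 2 → Submodule k (Hom X Y)
  isCompl_homog : ∀ X Y, IsCompl (homog X Y 0) (homog X Y 1)
  id : ∀ X, Hom X X
  comp : ∀ {X Y Z}, Hom Y Z →ₗ[k] Hom X Y →ₗ[k] Hom X Z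
  tensor : ∀ {X Y Z W}, Hom X Y →ₗ[k] Hom Z W →ₗ[k] Hom (X + Z) (Y + W)
  id_homog : ∀ X, id X ∈ homog X X 0
  comp_homog : ∀ {X Y Z} (p q : ZMod 2) (f : Hom Y Z) (g : Hom X Y),
    f ∈ homog Y Z p → g ∈ homog X Y q → comp f g ∈ homog X Z (p + q)
  tensor_homog : ∀ {X Y Z W} (p q : ZMod 2) (f : Hom X Y) (g : Hom Z W),
    f ∈ homog X Y p → g ∈ homog Z W q → tensor f g ∈ homog (X + Z) (Y + W) (p + q)
  id_comp : ∀ {X Y} (f : Hom X Y), comp (id Y) f = f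
  comp_id : ∀ {X Y} (f : Hom X Y), comp f (id X) = f
  comp_assoc : ∀ {X Y Z W} (f : Hom Z W) (g : Hom Y Z) (h : Hom X Y),
    comp (comp f g) h = comp f (comp g h)
  tensor_id : ∀ X Y, tensor (id X) (id Y) = id (X + Y)
  super_interchange : ∀ {X Y Z X' Y' Z'} (p q : ZMod 2) (f : Hom Y Z) (g : Hom Y' Z')
    (h : Hom X Y) (l : Hom X' Y'), g ∈ homog Y' Z' p → h ∈ homog X Y q →
    comp (tensor f g) (tensor h l) =
      ((-1 : k) ^ (p.val * q.val)) • tensor (comp f h) (comp g l)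
  tensor_assoc : ∀ {X Y X' Y' X'' Y''} (f : Hom X Y) (g : Hom X' Y') (h : Hom X'' Y''),
    HEq (tensor (tensor f g) h) (tensor f (tensor g h))
  unit_tensor : ∀ {X Y} (f : Hom X Y), HEq (tensor (id 0) f) f
  tensor_unit : ∀ {X Y} (f : Hom X Y), HEq (tensor f (id 0)) f

attribute [instance] StrictMonoidalSupercategory.objMonoid StrictMonoidalSupercategory.homGroup
  StrictMonoidalSupercategory.homModule

/-- String diagrams without crossings, from `m` points on the bottom to `n` points on the top:
everything obtained from vertical strands, cups and caps by vertical composition (`comp f g` is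
`f ∘ g`, that is, `f` on top of `g`) and horizontal composition (`tensor f g` has `f` on the
left). Diagrams may contain closed loops. -/
inductive Diagram : ℕ → ℕ → Type
  | id (n : ℕ) : Diagram n n
  | cup : Diagram 0 2
  | cap : Diagram 2 0
  | comp {l m n : ℕ} (f : Diagram m n) (g : Diagram l m) : Diagram l n
  | tensor {a b c d : ℕ} (f : Diagram a b) (g : Diagram c d) : Diagram (a + c) (b + d)

namespace Diagram

/-- The number of cups and caps in a diagram. As both are odd, the parity of the diagram is this
number modulo `2`. -/
def degree : {m n : ℕ} → Diagram m n → ℕ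
  | _, _, id _ => 0
  | _, _, cup => 1
  | _, _, cap => 1
  | _, _, comp f g => degree f + degree g
  | _, _, tensor f g => degree f + degree g

/-- The elementary moves between diagrams. `Move t e t'` says that `t` and `t'` differ by an
elementary planar isotopy, relative to the boundary, and that the axioms of a strict monoidal
supercategory together with the two zigzag relations give `t = e t'`, where `e = ±1`. -/
inductive Move : {m n : ℕ} → Diagram m n → ℤˣ → Diagram m n → Prop
  | id_comp {m n : ℕ} (f : Diagram m n) : Move (comp (id n) f) 1 f
  | comp_id {m n : ℕ} (f : Diagram m n) : Move (comp f (id m)) 1 f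
  | comp_assoc {a b c d : ℕ} (f : Diagram c d) (g : Diagram b c) (h : Diagram a b) :
      Move (comp (comp f g) h) 1 (comp f (comp g h))
  | tensor_id (m n : ℕ) : Move (tensor (id m) (id n)) 1 (id (m + n))
  | tensor_assoc {a b c d a' b' : ℕ} (f : Diagram a b) (g : Diagram c d) (h : Diagram a' b') :
      Move (homCast (add_assoc a c a') (add_assoc b d b') (tensor (tensor f g) h)) 1
        (tensor f (tensor g h))
  | unit_tensor {m n : ℕ} (f : Diagram m n) :
      Move (homCast (zero_add m) (zero_add n) (tensor (id 0) f)) 1 f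
  | tensor_unit {m n : ℕ} (f : Diagram m n) :
      Move (homCast (add_zero m) (add_zero n) (tensor f (id 0))) 1 f
  | super_interchange {a b c a' b' c' : ℕ} (f : Diagram b c) (g : Diagram b' c')
      (h : Diagram a b) (l : Diagram a' b') :
      Move (comp (tensor f g) (tensor h l)) ((-1) ^ (g.degree * h.degree))
        (tensor (comp f h) (comp g l))
  | zigzag_left : Move (m := 1) (n := 1)
      (comp (m := 3) (tensor cap (id 1)) (tensor (id 1) cup)) 1 (id 1)
  | zigzag_right : Move (m := 1) (n := 1)
      (comp (m := 3) (tensor (id 1) cap) (tensor cup (id 1))) (-1) (id 1)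

/-- Planar isotopy of diagrams relative to the boundary: the equivalence relation generated by
the elementary moves applied (with their signs ignored) anywhere inside a diagram. -/
inductive Isotopic : {m n : ℕ} → Diagram m n → Diagram m n → Prop
  | refl {m n : ℕ} (t : Diagram m n) : Isotopic t t
  | symm {m n : ℕ} {t t' : Diagram m n} : Isotopic t t' → Isotopic t' t
  | trans {m n : ℕ} {t t' t'' : Diagram m n} :
      Isotopic t t' → Isotopic t' t'' → Isotopic t t''
  | move {m n : ℕ} {t t' : Diagram m n} (e : ℤˣ) : Move t e t' → Isotopic t t'
  | comp {l m n : ℕ} {f f' : Diagram m n} {g g' : Diagram l m} :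
      Isotopic f f' → Isotopic g g' → Isotopic (comp f g) (comp f' g')
  | tensor {a b c d : ℕ} {f f' : Diagram a b} {g g' : Diagram c d} :
      Isotopic f f' → Isotopic g g' → Isotopic (tensor f g) (tensor f' g')

/-- The elementary arcs (vertical strands, cups and caps) a diagram is made of. -/
def Arc : {m n : ℕ} → Diagram m n → Type
  | _, _, id n => Fin n
  | _, _, cup => Unit
  | _, _, cap => Unit
  | _, _, comp f g => Arc f ⊕ Arc g
  | _, _, tensor f g => Arc f ⊕ Arc g

/-- The elementary arc that ends at a given point of the bottom boundary. -/
def bottomArc : {m n : ℕ} → (t : Diagram m n) → Fin m → Arc t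
  | _, _, id _ => fun i => i
  | _, _, cup => fun i => i.elim0
  | _, _, cap => fun _ => ()
  | _, _, comp _ g => fun i => Sum.inr (bottomArc g i)
  | _, _, tensor f g =>
      Fin.addCases (fun i => Sum.inl (bottomArc f i)) (fun i => Sum.inr (bottomArc g i))

/-- The elementary arc that ends at a given point of the top boundary. -/
def topArc : {m n : ℕ} → (t : Diagram m n) → Fin n → Arc t
  | _, _, id _ => fun i => i
  | _, _, cup => fun _ => ()
  | _, _, cap => fun i => i.elim0
  | _, _, comp f _ => fun i => Sum.inl (topArc f i)
  | _, _, tensor f g =>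
      Fin.addCases (fun i => Sum.inl (topArc f i)) (fun i => Sum.inr (topArc g i))

/-- Two elementary arcs are joined if they meet at an interior point of the diagram, where two of
its parts have been stacked. -/
def Joined : {m n : ℕ} → (t : Diagram m n) → Arc t → Arc t → Prop
  | _, _, id _ => fun _ _ => False
  | _, _, cup => fun _ _ => False
  | _, _, cap => fun _ _ => False
  | _, _, comp f g => fun
      | Sum.inl x, Sum.inl y => Joined f x y
      | Sum.inr x, Sum.inr y => Joined g x y
      | Sum.inl x, Sum.inr y => ∃ i, x = bottomArc f i ∧ y = topArc g i
      | Sum.inr _, Sum.inl _ => False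
  | _, _, tensor f g => fun
      | Sum.inl x, Sum.inl y => Joined f x y
      | Sum.inr x, Sum.inr y => Joined g x y
      | Sum.inl _, Sum.inr _ => False
      | Sum.inr _, Sum.inl _ => False

/-- A diagram is a crossingless matching of its boundary points if it has no closed loops: each
of its connected components reaches the boundary. -/
def IsCrossinglessMatching {m n : ℕ} (t : Diagram m n) : Prop :=
  ∀ x : Arc t, (∃ i, Relation.EqvGen (Joined t) x (bottomArc t i)) ∨
    ∃ j, Relation.EqvGen (Joined t) x (topArc t j)

/-- `S` is a set of representatives for the isotopy classes of crossingless matchings from `m`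
points to `n` points. -/
def IsSetOfRepresentatives {m n : ℕ} (S : Set (Diagram m n)) : Prop :=
  (∀ s ∈ S, IsCrossinglessMatching s) ∧
    ∀ t : Diagram m n, IsCrossinglessMatching t → ∃! s, s ∈ S ∧ Isotopic t s

end Diagram

namespace STL

open Diagram

variable {k : Type w} [Field k]

/-- `Rel δ t c t'` says that `t = c t'` is one of the following relations, applied anywhere inside
a diagram: an axiom of strict monoidal supercategories, a zigzag relation, or the relation that a
closed bubble equals `δ`. -/
inductive Rel (δ : k) : {m n : ℕ} → Diagram m n → k → Diagram m n → Prop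
  | move {m n : ℕ} {t t' : Diagram m n} {e : ℤˣ} : Move t e t' → Rel δ t ((e : ℤ) : k) t'
  | bubble : Rel δ (comp cap cup) δ (id 0)
  | comp_left {l m n : ℕ} {c : k} {f f' : Diagram m n} (g : Diagram l m) :
      Rel δ f c f' → Rel δ (comp f g) c (comp f' g)
  | comp_right {l m n : ℕ} {c : k} (f : Diagram m n) {g g' : Diagram l m} :
      Rel δ g c g' → Rel δ (comp f g) c (comp f g')
  | tensor_left {a b a' b' : ℕ} {c : k} {f f' : Diagram a b} (g : Diagram a' b') :
      Rel δ f c f' → Rel δ (tensor f g) c (tensor f' g)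
  | tensor_right {a b a' b' : ℕ} {c : k} (f : Diagram a b) {g g' : Diagram a' b'} :
      Rel δ g c g' → Rel δ (tensor f g) c (tensor f g')

/-- The span of all relations between diagrams from `m` points to `n` points. -/
noncomputable def relations (δ : k) (m n : ℕ) : Submodule k (Diagram m n →₀ k) :=
  Submodule.span k {x | ∃ t c t', Rel δ t c t' ∧
    x = Finsupp.single t 1 - Finsupp.single t' c}

/-- The morphism space from `m` to `n`: formal linear combinations of diagrams, modulo the
relations. -/
noncomputable abbrev Hom (δ : k) (m n : ℕ) : Type w := (Diagram m n →₀ k) ⧸ relations δ m n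

/-- The morphism that a diagram defines. -/
noncomputable def ofDiagram (δ : k) {m n : ℕ} (t : Diagram m n) : Hom δ m n :=
  (relations δ m n).mkQ (Finsupp.single t 1)

theorem ofDiagram_rel {δ c : k} {m n : ℕ} {t t' : Diagram m n} (h : Rel δ t c t') :
    ofDiagram δ t = c • ofDiagram δ t' := by
  rw [ofDiagram, ofDiagram, ← map_smul, ← sub_eq_zero, ← map_sub, Submodule.mkQ_apply,
    Submodule.Quotient.mk_eq_zero]
  exact Submodule.subset_span ⟨t, c, t', h, by simp⟩

theorem ofDiagram_move_one {δ : k} {m n : ℕ} {t t' : Diagram m n} (h : Move t 1 t') :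
    ofDiagram δ t = ofDiagram δ t' := by
  simpa using ofDiagram_rel (Rel.move (δ := δ) h)

theorem induction {δ : k} {m n : ℕ} {P : Hom δ m n → Prop} (x : Hom δ m n)
    (of : ∀ t, P (ofDiagram δ t)) (zero : P 0) (add : ∀ x y, P x → P y → P (x + y))
    (smul : ∀ (c : k) x, P x → P (c • x)) : P x := by
  obtain ⟨x, rfl⟩ := (relations δ m n).mkQ_surjective x
  induction x using Finsupp.induction_linear with
  | zero => simpa using zero
  | add f g hf hg => rw [map_add]; exact add _ _ hf hg
  | single t c =>
    have h : (relations δ m n).mkQ (Finsupp.single t c) = c • ofDiagram δ t := by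
      rw [ofDiagram, ← map_smul]; simp
    rw [h]; exact smul _ _ (of t)

/-- A linear map out of a morphism space, from its values on diagrams. -/
noncomputable def lift {δ : k} {m n : ℕ} {M : Type*} [AddCommGroup M] [Module k M]
    (φ : Diagram m n → M) (hφ : ∀ t c t', Rel δ t c t' → φ t = c • φ t') :
    Hom δ m n →ₗ[k] M :=
  (relations δ m n).liftQ (Finsupp.linearCombination k φ) (by
    rw [relations, Submodule.span_le]
    rintro _ ⟨t, c, t', h, rfl⟩
    simp [hφ t c t' h])

@[simp] theorem lift_ofDiagram {δ : k} {m n : ℕ} {M : Type*} [AddCommGroup M] [Module k M]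
    (φ : Diagram m n → M) (hφ : ∀ t c t', Rel δ t c t' → φ t = c • φ t') (t : Diagram m n) :
    lift φ hφ (ofDiagram δ t) = φ t := by
  simp [lift, ofDiagram]

/-- Vertical composition, extended bilinearly from diagrams. -/
noncomputable def comp {δ : k} {l m n : ℕ} : Hom δ m n →ₗ[k] Hom δ l m →ₗ[k] Hom δ l n :=
  lift (fun f => lift (fun g => ofDiagram δ (Diagram.comp f g))
      (fun _ _ _ h => ofDiagram_rel (.comp_right f h)))
    (fun f c f' h => by
      refine LinearMap.ext fun x => ?_
      induction x using STL.induction with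
      | of g => simpa using ofDiagram_rel (.comp_left g h)
      | zero => simp
      | add x y hx hy => simp [hx, hy]
      | smul c x hx => simp [hx])

@[simp] theorem comp_ofDiagram {δ : k} {l m n : ℕ} (f : Diagram m n) (g : Diagram l m) :
    comp (ofDiagram δ f) (ofDiagram δ g) = ofDiagram δ (Diagram.comp f g) := by
  simp [comp]

/-- Horizontal composition, extended bilinearly from diagrams. -/
noncomputable def tensor {δ : k} {a b c d : ℕ} :
    Hom δ a b →ₗ[k] Hom δ c d →ₗ[k] Hom δ (a + c) (b + d) :=
  lift (fun f => lift (fun g => ofDiagram δ (Diagram.tensor f g))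
      (fun _ _ _ h => ofDiagram_rel (.tensor_right f h)))
    (fun f c f' h => by
      refine LinearMap.ext fun x => ?_
      induction x using STL.induction with
      | of g => simpa using ofDiagram_rel (.tensor_left g h)
      | zero => simp
      | add x y hx hy => simp [hx, hy]
      | smul c x hx => simp [hx])

@[simp] theorem tensor_ofDiagram {δ : k} {a b c d : ℕ} (f : Diagram a b) (g : Diagram c d) :
    tensor (ofDiagram δ f) (ofDiagram δ g) = ofDiagram δ (Diagram.tensor f g) := by
  simp [tensor]

/-- The homogeneous morphisms of parity `p`. -/
noncomputable def homog (δ : k) (m n : ℕ) (p : ZMod 2) : Submodule k (Hom δ m n) :=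
  Submodule.span k {x | ∃ t : Diagram m n, (t.degree : ZMod 2) = p ∧ x = ofDiagram δ t}

theorem ofDiagram_mem_homog (δ : k) {m n : ℕ} (t : Diagram m n) {p : ZMod 2}
    (h : (t.degree : ZMod 2) = p) : ofDiagram δ t ∈ homog δ m n p :=
  Submodule.subset_span ⟨t, h, rfl⟩

theorem degree_homCast {a a' b b' : ℕ} (ha : a = a') (hb : b = b') (t : Diagram a b) :
    (homCast ha hb t).degree = t.degree := by
  subst ha; subst hb; rfl

theorem degree_move {m n : ℕ} {t t' : Diagram m n} {e : ℤˣ} (h : Move t e t') :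
    (t.degree : ZMod 2) = t'.degree := by
  cases h <;> simp only [degree_homCast, degree] <;> push_cast <;> first | ring1 | rfl

theorem degree_rel {δ c : k} {m n : ℕ} {t t' : Diagram m n} (h : Rel δ t c t') :
    (t.degree : ZMod 2) = t'.degree := by
  induction h with
  | move h => exact degree_move h
  | bubble => rfl
  | comp_left g _ ih => simp [degree, ih]
  | comp_right f _ ih => simp [degree, ih]
  | tensor_left g _ ih => simp [degree, ih]
  | tensor_right f _ ih => simp [degree, ih]

theorem isCompl_homog (δ : k) (m n : ℕ) : IsCompl (homog δ m n 0) (homog δ m n 1) := by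
  let P : Hom δ m n →ₗ[k] Hom δ m n :=
    lift (fun t => if (t.degree : ZMod 2) = 0 then ofDiagram δ t else 0) (by
      intro t c t' h
      rw [degree_rel h, ofDiagram_rel h]
      split_ifs <;> simp)
  have h0 : ∀ x ∈ homog δ m n 0, P x = x := by
    intro x hx
    induction hx using Submodule.span_induction with
    | mem x hx => obtain ⟨t, ht, rfl⟩ := hx; simp [P, ht]
    | zero => simp
    | add x y _ _ hx hy => rw [map_add, hx, hy]
    | smul c x _ hx => rw [map_smul, hx]
  have h1 : ∀ x ∈ homog δ m n 1, P x = 0 := by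
    intro x hx
    induction hx using Submodule.span_induction with
    | mem x hx => obtain ⟨t, ht, rfl⟩ := hx; simp [P, ht]
    | zero => simp
    | add x y _ _ hx hy => rw [map_add, hx, hy, add_zero]
    | smul c x _ hx => rw [map_smul, hx, smul_zero]
  constructor
  · rw [Submodule.disjoint_def]
    intro x hx hx'
    rw [← h0 x hx, h1 x hx']
  · rw [codisjoint_iff, eq_top_iff]
    intro x _
    induction x using STL.induction with
    | of t =>
      have h : ∀ p : ZMod 2, p = 0 ∨ p = 1 := by decide
      rcases h (t.degree : ZMod 2) with h | h
      · exact Submodule.mem_sup_left (ofDiagram_mem_homog δ t h)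
      · exact Submodule.mem_sup_right (ofDiagram_mem_homog δ t h)
    | zero => exact Submodule.zero_mem _
    | add x y hx hy => exact Submodule.add_mem _ (hx trivial) (hy trivial)
    | smul c x hx => exact Submodule.smul_mem _ _ (hx trivial)

theorem bilin_homog {δ : k} {a b a' b' a'' b'' : ℕ}
    (B : Hom δ a b →ₗ[k] Hom δ a' b' →ₗ[k] Hom δ a'' b'') (p q : ZMod 2)
    (h : ∀ (f : Diagram a b) (g : Diagram a' b'), (f.degree : ZMod 2) = p →
      (g.degree : ZMod 2) = q → B (ofDiagram δ f) (ofDiagram δ g) ∈ homog δ a'' b'' (p + q))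
    (x : Hom δ a b) (y : Hom δ a' b') (hx : x ∈ homog δ a b p) (hy : y ∈ homog δ a' b' q) :
    B x y ∈ homog δ a'' b'' (p + q) := by
  induction hx using Submodule.span_induction with
  | mem x hx =>
    obtain ⟨f, hf, rfl⟩ := hx
    induction hy using Submodule.span_induction with
    | mem y hy => obtain ⟨g, hg, rfl⟩ := hy; exact h f g hf hg
    | zero => simp
    | add x y _ _ hx hy => rw [map_add]; exact Submodule.add_mem _ hx hy
    | smul c x _ hx => rw [map_smul]; exact Submodule.smul_mem _ _ hx
  | zero => simp
  | add x y _ _ hx hy =>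
    rw [map_add, LinearMap.add_apply]; exact Submodule.add_mem _ hx hy
  | smul c x _ hx =>
    rw [map_smul, LinearMap.smul_apply]; exact Submodule.smul_mem _ _ hx

theorem comp_assoc {δ : k} {a b c d : ℕ} (x : Hom δ c d) (y : Hom δ b c) (z : Hom δ a b) :
    comp (comp x y) z = comp x (comp y z) := by
  induction x using STL.induction with
  | of f =>
    induction y using STL.induction with
    | of g =>
      induction z using STL.induction with
      | of h => simpa using ofDiagram_move_one (.comp_assoc f g h)
      | zero => simp
      | add x y hx hy => simp only [map_add, hx, hy]
      | smul c x hx => simp only [map_smul, hx]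
    | zero => simp
    | add x y hx hy => simp only [map_add, LinearMap.add_apply, hx, hy]
    | smul c x hx => simp only [map_smul, LinearMap.smul_apply, hx]
  | zero => simp
  | add x y hx hy => simp only [map_add, LinearMap.add_apply, hx, hy]
  | smul c x hx => simp only [map_smul, LinearMap.smul_apply, hx]

theorem neg_one_pow_degree (a b : ℕ) :
    ((((-1 : ℤˣ) ^ (a * b) : ℤˣ) : ℤ) : k) =
      (-1) ^ ((a : ZMod 2).val * (b : ZMod 2).val) := by
  have h : (a * b) % 2 = ((a : ZMod 2).val * (b : ZMod 2).val) % 2 := by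
    rw [ZMod.val_natCast, ZMod.val_natCast, ← Nat.mul_mod]
  push_cast
  rw [neg_one_pow_eq_pow_mod_two, h, ← neg_one_pow_eq_pow_mod_two]

theorem super_interchange {δ : k} {a b c a' b' c' : ℕ} (p q : ZMod 2) (x : Hom δ b c)
    (y : Hom δ b' c') (z : Hom δ a b) (w : Hom δ a' b')
    (hy : y ∈ homog δ b' c' p) (hz : z ∈ homog δ a b q) :
    comp (tensor x y) (tensor z w) =
      ((-1 : k) ^ (p.val * q.val)) • tensor (comp x z) (comp y w) := by
  induction hy using Submodule.span_induction with
  | mem y hy =>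
    obtain ⟨g, rfl, rfl⟩ := hy
    induction hz using Submodule.span_induction with
    | mem z hz =>
      obtain ⟨h, rfl, rfl⟩ := hz
      induction x using STL.induction with
      | of f =>
        induction w using STL.induction with
        | of l =>
          simp only [tensor_ofDiagram, comp_ofDiagram]
          rw [← neg_one_pow_degree]
          exact ofDiagram_rel (.move (.super_interchange f g h l))
        | zero => simp
        | add x y hx hy => simp only [map_add, hx, hy, smul_add]
        | smul c x hx => simp only [map_smul, hx, smul_comm c]
      | zero => simp
      | add x y hx hy => simp only [map_add, LinearMap.add_apply, hx, hy, smul_add]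
      | smul c x hx => simp only [map_smul, LinearMap.smul_apply, hx, smul_comm c]
    | zero => simp
    | add x y _ _ hx hy => simp only [map_add, LinearMap.add_apply, hx, hy, smul_add]
    | smul c x _ hx => simp only [map_smul, LinearMap.smul_apply, hx, smul_comm c]
  | zero => simp
  | add x y _ _ hx hy => simp only [map_add, LinearMap.add_apply, hx, hy, smul_add]
  | smul c x _ hx => simp only [map_smul, LinearMap.smul_apply, hx, smul_comm c]

/-- Transport along equalities of objects, as a linear map. -/
noncomputable def castLin (δ : k) {a a' b b' : ℕ} (ha : a = a') (hb : b = b') :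
    Hom δ a b →ₗ[k] Hom δ a' b' where
  toFun := homCast ha hb
  map_add' x y := by subst ha; subst hb; rfl
  map_smul' c x := by subst ha; subst hb; rfl

theorem castLin_ofDiagram (δ : k) {a a' b b' : ℕ} (ha : a = a') (hb : b = b')
    (t : Diagram a b) :
    castLin δ ha hb (ofDiagram δ t) = ofDiagram δ (homCast ha hb t) := by
  subst ha; subst hb; rfl

theorem heq_of_castLin {δ : k} {a a' b b' : ℕ} {ha : a = a'} {hb : b = b'} {x : Hom δ a b}
    {y : Hom δ a' b'} (h : castLin δ ha hb x = y) : HEq x y := by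
  subst h; exact heq_homCast ha hb x

theorem tensor_assoc {δ : k} {a b a' b' a'' b'' : ℕ} (x : Hom δ a b) (y : Hom δ a' b')
    (z : Hom δ a'' b'') :
    castLin δ (add_assoc a a' a'') (add_assoc b b' b'') (tensor (tensor x y) z) =
      tensor x (tensor y z) := by
  induction x using STL.induction with
  | of f =>
    induction y using STL.induction with
    | of g =>
      induction z using STL.induction with
      | of h =>
        simp only [tensor_ofDiagram, castLin_ofDiagram]
        exact ofDiagram_move_one (.tensor_assoc f g h)
      | zero => simp
      | add x y hx hy => simp only [map_add, hx, hy]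
      | smul c x hx => simp only [map_smul, hx]
    | zero => simp
    | add x y hx hy => simp only [map_add, LinearMap.add_apply, hx, hy]
    | smul c x hx => simp only [map_smul, LinearMap.smul_apply, hx]
  | zero => simp
  | add x y hx hy => simp only [map_add, LinearMap.add_apply, hx, hy]
  | smul c x hx => simp only [map_smul, LinearMap.smul_apply, hx]

end STL

open STL in
/-- The odd Temperley-Lieb supercategory `STL(δ)`: the strict monoidal supercategory with one
generating object, whose `n`-fold tensor power is written `n`, and two odd generating
morphisms, the cup and the cap, subject to the two zigzag relations and the bubble relation. -/
noncomputable abbrev oddTemperleyLieb {k : Type w} [Field k] (δ : k) :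
    StrictMonoidalSupercategory.{0, w, w} k where
  Obj := ℕ
  Hom := STL.Hom δ
  homog := STL.homog δ
  isCompl_homog := STL.isCompl_homog δ
  id n := ofDiagram δ (.id n)
  comp := STL.comp
  tensor := STL.tensor
  id_homog n := ofDiagram_mem_homog δ _ (by simp [Diagram.degree])
  comp_homog p q := bilin_homog _ p q fun f g hf hg => by
    rw [comp_ofDiagram]; exact ofDiagram_mem_homog δ _ (by simp [Diagram.degree, hf, hg])
  tensor_homog p q := bilin_homog _ p q fun f g hf hg => by
    rw [tensor_ofDiagram]; exact ofDiagram_mem_homog δ _ (by simp [Diagram.degree, hf, hg])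
  id_comp x := by
    induction x using STL.induction with
    | of f => simpa using ofDiagram_move_one (.id_comp f)
    | zero => simp
    | add x y hx hy => simp only [map_add, hx, hy]
    | smul c x hx => simp only [map_smul, hx]
  comp_id x := by
    induction x using STL.induction with
    | of f => simpa using ofDiagram_move_one (.comp_id f)
    | zero => simp
    | add x y hx hy => simp only [map_add, LinearMap.add_apply, hx, hy]
    | smul c x hx => simp only [map_smul, LinearMap.smul_apply, hx]
  comp_assoc := STL.comp_assoc
  tensor_id m n := by simpa using ofDiagram_move_one (.tensor_id m n)
  super_interchange := STL.super_interchange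
  tensor_assoc x y z := heq_of_castLin (STL.tensor_assoc x y z)
  unit_tensor {m n} x := by
    apply heq_of_castLin (ha := zero_add m) (hb := zero_add n)
    induction x using STL.induction with
    | of f =>
      simp only [tensor_ofDiagram, castLin_ofDiagram]
      exact ofDiagram_move_one (.unit_tensor f)
    | zero => simp
    | add x y hx hy => simp only [map_add, hx, hy]
    | smul c x hx => simp only [map_smul, hx]
  tensor_unit {m n} x := by
    apply heq_of_castLin (ha := add_zero m) (hb := add_zero n)
    induction x using STL.induction with
    | of f =>
      simp only [tensor_ofDiagram, castLin_ofDiagram]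
      exact ofDiagram_move_one (.tensor_unit f)
    | zero => simp
    | add x y hx hy => simp only [map_add, LinearMap.add_apply, hx, hy]
    | smul c x hx => simp only [map_smul, LinearMap.smul_apply, hx]

/-- The morphism of `STL(δ)` that a string diagram defines. -/
noncomputable def oddTemperleyLieb.ofDiagram {k : Type w} [Field k] (δ : k) {m n : ℕ}
    (t : Diagram m n) : (oddTemperleyLieb δ).Hom m n :=
  STL.ofDiagram δ t

/-! The proof has a spanning half and an independence half, joined by a normal form: a normal
diagram is a composite of caps followed by a composite of cups, each with its positions in
increasing order.

Spanning. A cap stacked on a composite of cups commutes with a distant cup, cancels against a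
neighbouring one by a zigzag, or closes up with one to a circle; otherwise it passes to the bottom.
Sorting the cups on each side then shows that each diagram becomes normal after isotopy and removal
of `j` circles (`reducesToCapsCups`, `Diagram.exists_isNormal`). In `STL(δ)` isotopy costs a sign
and each circle a factor `δ`.

Independence. Diagrams act by matrices on tensor powers of a superspace of dimension `(1|1)`
(`superModel`). A normal half-diagram with `p` through strands is determined by the word `u` marking
left ends of cups by `false` and everything else by `true`. In its image of the all-`true` word, `u`
is the least word with nonzero coefficient. Together with conservation of weight (number of `true`
minus number of `false`), this makes suitable matrix entries triangular on normal diagrams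
(`linearIndependent_isNormal`).

Matchings. The number of `j` above must be seen to vanish for a crossingless matching. A second
matrix model, over `ℕ` and without signs, counts two-colorings of the components (`coloringModel`).
With constant boundary coloring the count is `1` exactly when there is no closed loop. Normal
diagrams have count `1` and removing a circle divides the count by `2`, so a crossingless matching
is isotopic to a normal diagram, with no circle removed. Hence representatives of the isotopy
classes agree up to sign with distinct normal diagrams, and they inherit both halves. -/

/-! ### Words in two letters, as indices for bases of tensor powers. -/

/-- The words of length `n` in two letters. -/
def words : ℕ → Finset (List Bool)
  | 0 => {[]}
  | n + 1 => (words n).image (List.cons false) ∪ (words n).image (List.cons true)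

theorem mem_words {n : ℕ} {x : List Bool} : x ∈ words n ↔ x.length = n := by
  induction n generalizing x with
  | zero => simp [words]
  | succ n ih =>
    cases x with
    | nil => simp [words]
    | cons b x => cases b <;> simp [words, ih]

theorem sum_words_zero {R : Type*} [AddCommMonoid R] (f : List Bool → R) :
    ∑ x ∈ words 0, f x = f [] := by simp [words]

theorem sum_words_succ {R : Type*} [AddCommMonoid R] (n : ℕ) (f : List Bool → R) :
    ∑ x ∈ words (n + 1), f x =
      ∑ x ∈ words n, f (false :: x) + ∑ x ∈ words n, f (true :: x) := by
  rw [words, Finset.sum_union, Finset.sum_image, Finset.sum_image]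
  · intro a _ b _ h; simpa using h
  · intro a _ b _ h; simpa using h
  · rw [Finset.disjoint_left]
    intro a h h'
    simp only [Finset.mem_image] at h h'
    obtain ⟨b, _, rfl⟩ := h
    obtain ⟨c, _, h⟩ := h'
    simp at h

theorem sum_words_add {R : Type*} [AddCommMonoid R] (m n : ℕ) (f : List Bool → R) :
    ∑ x ∈ words (m + n), f x = ∑ x ∈ words m, ∑ y ∈ words n, f (x ++ y) := by
  induction m generalizing f with
  | zero => simp [words]
  | succ m ih =>
    rw [Nat.add_right_comm, sum_words_succ, sum_words_succ, ih, ih]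
    rfl

theorem exists_append_of_length {m n : ℕ} {x : List Bool} (h : x.length = m + n) :
    ∃ y z, x = y ++ z ∧ y.length = m ∧ z.length = n :=
  ⟨x.take m, x.drop m, (List.take_append_drop m x).symm, by simp [h], by simp [h]⟩

/-- The number of odd letters of a word; the letter `true` is odd. -/
def oddCount (x : List Bool) : ℕ := x.count true

theorem oddCount_append (x y : List Bool) : oddCount (x ++ y) = oddCount x + oddCount y :=
  List.count_append

/-! ### Matrix models of diagrams and their invariance under the moves. -/

/-- Matrices for a cup and a cap on a free module with basis indexed by `Bool`, for which the
zigzag relations hold. The character `χ` says how signs act: `χ (-1) = -1` for superspaces, and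
`χ = 1` if signs are to be ignored. -/
structure StringModel (R : Type*) [CommSemiring R] where
  χ : ℤˣ →* R
  cup : Bool → Bool → R
  cap : Bool → Bool → R
  bubble : R
  parity_cup : ∀ x y, χ (-1) ^ oddCount [x, y] * cup x y = χ (-1) * cup x y
  parity_cap : ∀ x y, χ (-1) ^ oddCount [x, y] * cap x y = χ (-1) * cap x y
  zigzag_left : ∀ x y, χ (-1) ^ oddCount [x] * ∑ z, cap x z * cup z y = if y = x then 1 else 0
  zigzag_right : ∀ x y,
    χ (-1) ^ oddCount [y] * ∑ z, cup y z * cap z x = χ (-1) * if y = x then 1 else 0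
  bubble_eq : ∑ x, ∑ y, cap x y * cup x y = bubble

namespace StringModel

open Diagram

variable {R : Type*} [CommSemiring R] (M : StringModel R)

/-- The scalar by which `-1` acts. -/
def sgn : R := M.χ (-1)

theorem sgn_mul_sgn : M.sgn * M.sgn = 1 := by
  rw [sgn, ← map_mul]; simp

/-- The value of a cup on a word. -/
def cupWord : List Bool → R
  | [x, y] => M.cup x y
  | _ => 0

/-- The value of a cap on a word. -/
def capWord : List Bool → R
  | [x, y] => M.cap x y
  | _ => 0

/-- The matrix of a diagram. Rows are indexed by words on the top boundary, columns by words on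
the bottom boundary. -/
def eval : {m n : ℕ} → Diagram m n → List Bool → List Bool → R
  | _, _, .id _ => fun x y => if x = y then 1 else 0
  | _, _, .cup => fun x _ => M.cupWord x
  | _, _, .cap => fun _ y => M.capWord y
  | _, _, @Diagram.comp _ m _ f g => fun x y => ∑ z ∈ words m, eval f x z * eval g z y
  | _, _, @Diagram.tensor a b _ _ f g => fun x y =>
      -- The Koszul sign: `g` moves past the part of the input on which `f` acts.
      M.sgn ^ (g.degree * oddCount (y.take a)) *
        (eval f (x.take b) (y.take a) * eval g (x.drop b) (y.drop a))

theorem eval_homCast {a a' b b' : ℕ} (ha : a = a') (hb : b = b') (t : Diagram a b) :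
    M.eval (homCast ha hb t) = M.eval t := by
  subst ha; subst hb; rfl

theorem eval_id (n : ℕ) (x y : List Bool) :
    M.eval (.id n) x y = if x = y then 1 else 0 := rfl

theorem eval_comp {l m n : ℕ} (f : Diagram m n) (g : Diagram l m) (x y : List Bool) :
    M.eval (.comp f g) x y = ∑ z ∈ words m, M.eval f x z * M.eval g z y := rfl

theorem eval_tensor {a b c d : ℕ} (f : Diagram a b) (g : Diagram c d) (x y : List Bool) :
    M.eval (.tensor f g) x y = M.sgn ^ (g.degree * oddCount (y.take a)) *
        (M.eval f (x.take b) (y.take a) * M.eval g (x.drop b) (y.drop a)) := rfl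

theorem eval_tensor_append {a b c d : ℕ} (f : Diagram a b) (g : Diagram c d)
    {x x' y y' : List Bool} (hx : x.length = b) (hy : y.length = a) :
    M.eval (.tensor f g) (x ++ x') (y ++ y') =
      M.sgn ^ (g.degree * oddCount y) * (M.eval f x y * M.eval g x' y') := by
  subst hx hy
  simp [eval_tensor]

/-- The matrix of a diagram is homogeneous: a nonzero entry can only join words whose parities
differ by the degree. Writing this as an identity of signed entries makes sense over any semiring
and is vacuous when signs act trivially. -/
theorem parity_eval {m n : ℕ} (t : Diagram m n) : ∀ {x y : List Bool},
    x.length = n → y.length = m →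
    M.sgn ^ oddCount x * M.eval t x y = M.sgn ^ (t.degree + oddCount y) * M.eval t x y := by
  induction t with
  | id n =>
    intro x y _ _
    by_cases h : x = y
    · subst h; simp [degree]
    · simp [eval_id, h]
  | cup =>
    intro x y hx hy
    obtain ⟨a, b, rfl⟩ := List.length_eq_two.1 hx
    obtain rfl := List.length_eq_zero_iff.1 hy
    simpa [degree, oddCount, sgn, eval, cupWord] using M.parity_cup a b
  | cap =>
    intro x y hx hy
    obtain ⟨a, b, rfl⟩ := List.length_eq_two.1 hy
    obtain rfl := List.length_eq_zero_iff.1 hx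
    have h := M.parity_cap a b
    rw [degree, pow_add, pow_one, mul_assoc]
    change _ = _ * (_ * M.cap a b)
    rw [show M.sgn ^ oddCount [a, b] * M.cap a b = M.sgn * M.cap a b from h, ← mul_assoc,
      sgn_mul_sgn]
    simp [oddCount]; rfl
  | comp f g hf hg =>
    intro x y hx hy
    rw [eval_comp, Finset.mul_sum, Finset.mul_sum]
    refine Finset.sum_congr rfl fun z hz => ?_
    rw [mem_words] at hz
    calc _ = M.sgn ^ oddCount x * M.eval f x z * M.eval g z y := by ring
      _ = M.sgn ^ f.degree * M.eval f x z * (M.sgn ^ oddCount z * M.eval g z y) := by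
        rw [hf hx hz]; ring
      _ = _ := by rw [hg hz hy, degree]; ring
  | tensor f g hf hg =>
    intro x y hx hy
    obtain ⟨x, x', rfl, hx, hx'⟩ := exists_append_of_length hx
    obtain ⟨y, y', rfl, hy, hy'⟩ := exists_append_of_length hy
    rw [eval_tensor_append _ _ _ hx hy]
    rw [oddCount_append, oddCount_append]
    calc _ = M.sgn ^ (g.degree * oddCount y) * ((M.sgn ^ oddCount x * M.eval f x y) *
          (M.sgn ^ oddCount x' * M.eval g x' y')) := by ring
      _ = _ := by rw [hf hx hy, hg hx' hy', degree]; ring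

theorem sgn_pow_congr {a b : ℕ} (h : a % 2 = b % 2) : M.sgn ^ a = M.sgn ^ b := by
  rw [← Nat.div_add_mod a 2, ← Nat.div_add_mod b 2, h, pow_add, pow_add, pow_mul, pow_mul,
    pow_two, sgn_mul_sgn, one_pow, one_pow]

/-- On the left the Koszul sign of `g` involves the middle word `z`, on the right the bottom word
`y`. Homogeneity of `h` converts one into the other at the cost of `g.degree * h.degree`. -/
theorem eval_interchange {a b c a' b' c' : ℕ} (f : Diagram b c) (g : Diagram b' c')
    (h : Diagram a b) (l : Diagram a' b') {x y : List Bool} (hx : x.length = c + c')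
    (hy : y.length = a + a') :
    M.eval (.comp (.tensor f g) (.tensor h l)) x y =
      M.sgn ^ (g.degree * h.degree) * M.eval (.tensor (.comp f h) (.comp g l)) x y := by
  obtain ⟨x, x', rfl, hx, hx'⟩ := exists_append_of_length hx
  obtain ⟨y, y', rfl, hy, hy'⟩ := exists_append_of_length hy
  rw [eval_tensor_append _ _ _ hx hy, eval_comp, eval_comp, eval_comp, sum_words_add,
    Finset.sum_mul_sum, Finset.mul_sum, Finset.mul_sum]
  refine Finset.sum_congr rfl fun z hz => ?_
  rw [mem_words] at hz
  rw [Finset.mul_sum, Finset.mul_sum]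
  refine Finset.sum_congr rfl fun z' _ => ?_
  rw [eval_tensor_append _ _ _ hx hz, eval_tensor_append _ _ _ hz hy]
  -- Homogeneity of `h` in the power `e`, needed for `e = g.degree`. The entry of `h` stays as a
  -- factor because the signs agree only where it does not vanish.
  have key : ∀ e : ℕ, (M.sgn ^ oddCount z) ^ e * M.eval h z y =
      (M.sgn ^ (h.degree + oddCount y)) ^ e * M.eval h z y := by
    intro e
    induction e with
    | zero => simp
    | succ e ih =>
      calc _ = (M.sgn ^ oddCount z) ^ e * (M.sgn ^ oddCount z * M.eval h z y) := by ring
        _ = M.sgn ^ (h.degree + oddCount y) * ((M.sgn ^ oddCount z) ^ e * M.eval h z y) := by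
          rw [M.parity_eval h hz hy]; ring
        _ = _ := by rw [ih]; ring
  calc _ = ((M.sgn ^ oddCount z) ^ g.degree * M.eval h z y) * (M.sgn ^ (l.degree * oddCount y) *
        (M.eval f x z * M.eval g x' z' * M.eval l z' y')) := by ring
    _ = _ := by rw [key, degree]; ring

theorem eval_move {m n : ℕ} {t t' : Diagram m n} {e : ℤˣ} (h : Move t e t') {x y : List Bool}
    (hx : x.length = n) (hy : y.length = m) : M.eval t x y = M.χ e * M.eval t' x y := by
  cases h with
  | id_comp =>
    rw [map_one, one_mul, eval_comp]
    simp [eval_id, mem_words, hx]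
  | comp_id =>
    rw [map_one, one_mul, eval_comp]
    simp [eval_id, mem_words, hy]
  | comp_assoc f g h =>
    rw [map_one, one_mul]
    simp only [eval_comp, Finset.sum_mul, Finset.mul_sum, mul_assoc]
    exact Finset.sum_comm
  | tensor_id a b =>
    rw [map_one, one_mul]
    obtain ⟨x, x', rfl, hx, hx'⟩ := exists_append_of_length hx
    obtain ⟨y, y', rfl, hy, hy'⟩ := exists_append_of_length hy
    rw [eval_tensor_append _ _ _ hx hy]
    have h : x ++ x' = y ++ y' ↔ x = y ∧ x' = y' :=
      ⟨fun h => List.append_inj h (hx.trans hy.symm), fun h => by rw [h.1, h.2]⟩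
    simp only [eval_id, h, degree, zero_mul, pow_zero, ite_and, mul_ite, mul_one,
      mul_zero]
    split_ifs <;> rfl
  | tensor_assoc f g h =>
    rw [map_one, one_mul, eval_homCast]
    obtain ⟨x, u, rfl, hx₁, hu⟩ := exists_append_of_length hx
    obtain ⟨y, v, rfl, hy₁, hv⟩ := exists_append_of_length hy
    obtain ⟨x', x'', rfl, hx', hx''⟩ := exists_append_of_length hu
    obtain ⟨y', y'', rfl, hy', hy''⟩ := exists_append_of_length hv
    rw [eval_tensor_append _ _ _ hx₁ hy₁, eval_tensor_append _ _ _ hx' hy', ← List.append_assoc,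
      ← List.append_assoc, eval_tensor_append, eval_tensor_append _ _ _ hx₁ hy₁,
      oddCount_append, degree]
    · ring
    · simp [hx₁, hx']
    · simp [hy₁, hy']
  | unit_tensor =>
    rw [map_one, one_mul, eval_homCast, eval_tensor]
    simp [eval_id, oddCount]
  | tensor_unit =>
    rw [map_one, one_mul, eval_homCast, eval_tensor]
    simp [eval_id, ← hx, ← hy, degree]
  | super_interchange f g h l =>
    rw [eval_interchange _ _ _ _ _ hx hy, map_pow, sgn]
  | zigzag_left =>
    obtain ⟨a, rfl⟩ := List.length_eq_one_iff.1 hx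
    obtain ⟨b, rfl⟩ := List.length_eq_one_iff.1 hy
    have h := M.zigzag_left b a
    rw [map_one, one_mul, eval_id, eval_comp]
    cases a <;> cases b <;>
      simp [sum_words_succ, mem_words, eval, capWord, cupWord, oddCount, sgn, degree]
        at h ⊢ <;> refine Eq.trans ?_ h <;> ring
  | zigzag_right =>
    obtain ⟨a, rfl⟩ := List.length_eq_one_iff.1 hx
    obtain ⟨b, rfl⟩ := List.length_eq_one_iff.1 hy
    have h := M.zigzag_right b a
    rw [eval_id, eval_comp]
    cases a <;> cases b <;>
      simp [sum_words_succ, mem_words, eval, capWord, cupWord, oddCount, sgn, degree]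
        at h ⊢ <;> refine Eq.trans ?_ h <;> ring

theorem eval_bubble {x y : List Bool} (hx : x.length = 0) (hy : y.length = 0) :
    M.eval (.comp .cap .cup) x y = M.bubble * M.eval (.id 0) x y := by
  obtain rfl := List.length_eq_zero_iff.1 hx
  obtain rfl := List.length_eq_zero_iff.1 hy
  rw [← M.bubble_eq, eval_comp]
  simp [sum_words_succ, sum_words_zero, eval, capWord, cupWord]
  ring

/-- `M.Scales t c t'` says that the matrix of `t` is `c` times the matrix of `t'`. -/
def Scales {m n m' n' : ℕ} (t : Diagram m n) (c : R) (t' : Diagram m' n') : Prop :=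
  ∀ x y : List Bool, x.length = n → y.length = m → M.eval t x y = c * M.eval t' x y

theorem Scales.comp {l m n : ℕ} {f f' : Diagram m n} {g g' : Diagram l m} {c c' : R}
    (hf : M.Scales f c f') (hg : M.Scales g c' g') :
    M.Scales (.comp f g) (c * c') (.comp f' g') := by
  intro x y hx hy
  rw [eval_comp, eval_comp, Finset.mul_sum]
  refine Finset.sum_congr rfl fun z hz => ?_
  rw [mem_words] at hz
  rw [hf x z hx hz, hg z y hz hy]; ring

/-- The matrix of a tensor product involves the degree of its right factor through a sign, so
proportional matrices alone do not suffice: the parities must agree too. -/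
theorem Scales.tensor {a b a' b' : ℕ} {f f' : Diagram a b} {g g' : Diagram a' b'} {c c' : R}
    (hf : M.Scales f c f') (hg : M.Scales g c' g')
    (hdeg : (g.degree : ZMod 2) = g'.degree) :
    M.Scales (.tensor f g) (c * c') (.tensor f' g') := by
  intro x y hx hy
  have h : g.degree % 2 = g'.degree % 2 := (ZMod.natCast_eq_natCast_iff' _ _ _).1 hdeg
  rw [eval_tensor, eval_tensor, hf _ _ (by simp [hx]) (by simp [hy]),
    hg _ _ (by simp [hx]) (by simp [hy]),
    M.sgn_pow_congr (a := g.degree * _) (b := g'.degree * oddCount (y.take a))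
      (by rw [Nat.mul_mod, h, ← Nat.mul_mod])]
  ring

theorem Scales.refl {m n : ℕ} (t : Diagram m n) : M.Scales t 1 t := by
  intro x y _ _; rw [one_mul]

end StringModel

/-! ### Calculus of diagrams up to isotopy and removal of circles. -/

namespace Diagram

/-- `Reduces j t t'`: up to isotopy, `t'` is obtained from `t` by removing `j` small circles. -/
inductive Reduces : ℕ → {m n : ℕ} → Diagram m n → Diagram m n → Prop
  | isotopic {m n : ℕ} {t t' : Diagram m n} : Isotopic t t' → Reduces 0 t t'
  | bubble : Reduces 1 (comp cap cup) (id 0)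
  | trans {i j : ℕ} {m n : ℕ} {t t' t'' : Diagram m n} :
      Reduces i t t' → Reduces j t' t'' → Reduces (i + j) t t''
  | comp {i j : ℕ} {l m n : ℕ} {f f' : Diagram m n} {g g' : Diagram l m} :
      Reduces i f f' → Reduces j g g' → Reduces (i + j) (comp f g) (comp f' g')
  | tensor {i j : ℕ} {a b c d : ℕ} {f f' : Diagram a b} {g g' : Diagram c d} :
      Reduces i f f' → Reduces j g g' → Reduces (i + j) (tensor f g) (tensor f' g')

theorem Reduces.isotopic_of_eq_zero {j m n : ℕ} {t t' : Diagram m n} (h : Reduces j t t') :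
    j = 0 → Isotopic t t' := by
  induction h with
  | isotopic h => exact fun _ => h
  | bubble => intro h; cases h
  | trans _ _ h h' => intro e; exact (h (by omega)).trans (h' (by omega))
  | comp _ _ h h' => intro e; exact (h (by omega)).comp (h' (by omega))
  | tensor _ _ h h' => intro e; exact (h (by omega)).tensor (h' (by omega))

/-- `Reduces` for diagrams whose types are only propositionally equal. -/
def HReduces (j : ℕ) {m n m' n' : ℕ} (t : Diagram m n) (t' : Diagram m' n') : Prop :=
  ∃ (hm : m = m') (hn : n = n'), Reduces j (homCast hm hn t) t'

theorem HReduces.of_reduces {j m n : ℕ} {t t' : Diagram m n} (h : Reduces j t t') :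
    HReduces j t t' := ⟨rfl, rfl, h⟩

theorem HReduces.reduces {j m n : ℕ} {t t' : Diagram m n} (h : HReduces j t t') :
    Reduces j t t' := h.2.2

/-- Isotopy of diagrams whose types are only propositionally equal. -/
def HIsotopic {m n m' n' : ℕ} (t : Diagram m n) (t' : Diagram m' n') : Prop :=
  ∃ (hm : m = m') (hn : n = n'), Isotopic (homCast hm hn t) t'

infix:50 " ≈ᵢ " => HIsotopic

theorem HIsotopic.hreduces {m n m' n' : ℕ} {t : Diagram m n} {t' : Diagram m' n'}
    (h : t ≈ᵢ t') : HReduces 0 t t' := ⟨h.1, h.2.1, .isotopic h.2.2⟩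

theorem HIsotopic.of_move {m n : ℕ} {t t' : Diagram m n} {e : ℤˣ} (h : Move t e t') :
    t ≈ᵢ t' := ⟨rfl, rfl, .move e h⟩

@[refl] theorem HIsotopic.refl {m n : ℕ} (t : Diagram m n) : t ≈ᵢ t := ⟨rfl, rfl, .refl t⟩

theorem HIsotopic.homCast {m n m' n' : ℕ} (hm : m = m') (hn : n = n') (t : Diagram m n) :
    t ≈ᵢ homCast hm hn t := ⟨hm, hn, .refl _⟩

@[symm] theorem HIsotopic.symm {m n m' n' : ℕ} {t : Diagram m n} {t' : Diagram m' n'}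
    (h : t ≈ᵢ t') : t' ≈ᵢ t := by
  obtain ⟨rfl, rfl, h⟩ := h
  exact ⟨rfl, rfl, h.symm⟩

@[trans] theorem HIsotopic.trans {m n m' n' m'' n'' : ℕ} {t : Diagram m n} {t' : Diagram m' n'}
    {t'' : Diagram m'' n''} (h : t ≈ᵢ t') (h' : t' ≈ᵢ t'') : t ≈ᵢ t'' := by
  obtain ⟨rfl, rfl, h⟩ := h
  obtain ⟨rfl, rfl, h'⟩ := h'
  exact ⟨rfl, rfl, h.trans h'⟩

theorem HIsotopic.tensor {a b c d a' b' c' d' : ℕ} {f : Diagram a b} {g : Diagram c d}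
    {f' : Diagram a' b'} {g' : Diagram c' d'} (h : f ≈ᵢ f') (h' : g ≈ᵢ g') :
    tensor f g ≈ᵢ tensor f' g' := by
  obtain ⟨rfl, rfl, h⟩ := h
  obtain ⟨rfl, rfl, h'⟩ := h'
  exact ⟨rfl, rfl, h.tensor h'⟩

theorem HReduces.trans {i j m n m' n' m'' n'' : ℕ} {t : Diagram m n} {t' : Diagram m' n'}
    {t'' : Diagram m'' n''} (h : HReduces i t t') (h' : HReduces j t' t'') :
    HReduces (i + j) t t'' := by
  obtain ⟨rfl, rfl, h⟩ := h
  obtain ⟨rfl, rfl, h'⟩ := h'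
  exact ⟨rfl, rfl, h.trans h'⟩

theorem HIsotopic.trans_hreduces {j m n m' n' m'' n'' : ℕ} {t : Diagram m n}
    {t' : Diagram m' n'} {t'' : Diagram m'' n''} (h : t ≈ᵢ t') (h' : HReduces j t' t'') :
    HReduces j t t'' := by
  simpa using h.hreduces.trans h'

theorem HReduces.trans_hisotopic {j m n m' n' m'' n'' : ℕ} {t : Diagram m n}
    {t' : Diagram m' n'} {t'' : Diagram m'' n''} (h : HReduces j t t') (h' : t' ≈ᵢ t'') :
    HReduces j t t'' := h.trans h'.hreduces

/-- Composition of diagrams along a propositional equality of their types. -/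
def hcomp {l m m' n : ℕ} (f : Diagram m n) (g : Diagram l m') (h : m' = m) : Diagram l n :=
  comp f (homCast rfl h g)

theorem hcomp_rfl {l m n : ℕ} (f : Diagram m n) (g : Diagram l m) (h : m = m) :
    hcomp f g h = comp f g := rfl

theorem HIsotopic.hcomp {l m m' n l₁ m₁ m₁' n₁ : ℕ} {f : Diagram m n} {g : Diagram l m'}
    {h : m' = m} {f₁ : Diagram m₁ n₁} {g₁ : Diagram l₁ m₁'} (hf : f ≈ᵢ f₁) (hg : g ≈ᵢ g₁)
    (h₁ : m₁' = m₁) : hcomp f g h ≈ᵢ hcomp f₁ g₁ h₁ := by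
  obtain ⟨rfl, rfl, hf⟩ := hf
  obtain ⟨rfl, rfl, hg⟩ := hg
  subst h
  exact ⟨rfl, rfl, hf.comp hg⟩

theorem HReduces.hcomp {i j l m m' n l₁ m₁ m₁' n₁ : ℕ} {f : Diagram m n} {g : Diagram l m'}
    {h : m' = m} {f₁ : Diagram m₁ n₁} {g₁ : Diagram l₁ m₁'} (hf : HReduces i f f₁)
    (hg : HReduces j g g₁) (h₁ : m₁' = m₁) :
    HReduces (i + j) (hcomp f g h) (hcomp f₁ g₁ h₁) := by
  obtain ⟨rfl, rfl, hf⟩ := hf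
  obtain ⟨rfl, rfl, hg⟩ := hg
  subst h
  exact ⟨rfl, rfl, hf.comp hg⟩

theorem HReduces.refl {m n : ℕ} (t : Diagram m n) : HReduces 0 t t :=
  (HIsotopic.refl t).hreduces

theorem hcomp_assoc {a b b' c c' d : ℕ} (f : Diagram c' d) (g : Diagram b' c) (h : Diagram a b)
    (e : c = c') (e' : b = b') : hcomp (hcomp f g e) h e' ≈ᵢ hcomp f (hcomp g h e') e := by
  subst e e'
  exact .of_move (.comp_assoc f g h)

theorem id_hcomp {l m n : ℕ} (g : Diagram l m) (h : m = n) : hcomp (id n) g h ≈ᵢ g := by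
  subst h
  exact .of_move (.id_comp g)

theorem hcomp_id {m n l : ℕ} (f : Diagram m n) (h : l = m) : hcomp f (id l) h ≈ᵢ f := by
  subst h
  exact .of_move (.comp_id f)

theorem tensor_assoc {a b c d a' b' : ℕ} (f : Diagram a b) (g : Diagram c d)
    (h : Diagram a' b') : tensor (tensor f g) h ≈ᵢ tensor f (tensor g h) :=
  (HIsotopic.homCast _ _ _).trans (.of_move (.tensor_assoc f g h))

theorem id_zero_tensor {m n : ℕ} (f : Diagram m n) : tensor (id 0) f ≈ᵢ f :=
  (HIsotopic.homCast _ _ _).trans (.of_move (.unit_tensor f))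

theorem tensor_id_zero {m n : ℕ} (f : Diagram m n) : tensor f (id 0) ≈ᵢ f :=
  .of_move (.tensor_unit f)

theorem tensor_id_id (m n : ℕ) : tensor (id m) (id n) ≈ᵢ id (m + n) :=
  .of_move (.tensor_id m n)

theorem interchange {a b c a' b' c' : ℕ} (f : Diagram b c) (g : Diagram b' c')
    (h : Diagram a b) (l : Diagram a' b') :
    comp (tensor f g) (tensor h l) ≈ᵢ tensor (comp f h) (comp g l) :=
  .of_move (.super_interchange f g h l)

theorem HIsotopic.comp {l m n : ℕ} {f f' : Diagram m n} {g g' : Diagram l m} (h : f ≈ᵢ f')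
    (h' : g ≈ᵢ g') : comp f g ≈ᵢ comp f' g' := h.hcomp (h := rfl) h' rfl

/-- A diagram with `a` strands added on the left and `b` strands added on the right. -/
def whisker (a : ℕ) {m n : ℕ} (f : Diagram m n) (b : ℕ) : Diagram (a + m + b) (a + n + b) :=
  tensor (tensor (id a) f) (id b)

theorem whisker_id (a m b : ℕ) : whisker a (id m) b ≈ᵢ id (a + m + b) :=
  ((tensor_id_id a m).tensor (.refl _)).trans (tensor_id_id _ _)

theorem whisker_comp (a b : ℕ) {l m n : ℕ} (f : Diagram m n) (g : Diagram l m) :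
    whisker a (comp f g) b ≈ᵢ comp (whisker a f b) (whisker a g b) := by
  refine .symm ((interchange _ _ _ _).trans (.tensor ?_ (.of_move (.id_comp _))))
  exact (interchange _ _ _ _).trans (.tensor (.of_move (.id_comp _)) (.refl _))

theorem whisker_add (a b c : ℕ) {m n : ℕ} (f : Diagram m n) :
    whisker a f (b + c) ≈ᵢ tensor (whisker a f b) (id c) :=
  (HIsotopic.tensor (.refl _) (tensor_id_id b c).symm).trans (tensor_assoc _ _ _).symm

theorem whisker_congr {a a' b b' m n m' n' : ℕ} {f : Diagram m n} {f' : Diagram m' n'}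
    (ha : a = a') (h : f ≈ᵢ f') (hb : b = b') : whisker a f b ≈ᵢ whisker a' f' b' := by
  subst ha hb
  exact ((HIsotopic.refl _).tensor h).tensor (.refl _)

theorem whisker_zero_zero {m n : ℕ} (f : Diagram m n) : whisker 0 f 0 ≈ᵢ f :=
  (tensor_id_zero _).trans (id_zero_tensor f)

theorem tensor_eq_comp {a b c d : ℕ} (f : Diagram a b) (g : Diagram c d) :
    tensor f g ≈ᵢ comp (tensor f (id d)) (tensor (id a) g) :=
  .symm <| (interchange _ _ _ _).trans <|
    .tensor (.of_move (.comp_id f)) (.of_move (.id_comp g))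

theorem tensor_eq_comp' {a b c d : ℕ} (f : Diagram a b) (g : Diagram c d) :
    tensor f g ≈ᵢ comp (tensor (id b) g) (tensor f (id c)) :=
  .symm <| (interchange _ _ _ _).trans <|
    .tensor (.of_move (.id_comp f)) (.of_move (.comp_id g))

/-- Diagrams with disjoint supports commute. -/
theorem whisker_comm (a c b : ℕ) {m n m' n' : ℕ} (f : Diagram m n) (g : Diagram m' n')
    (h : a + m + c + n' + b = a + m + (c + n' + b))
    (h' : a + n + (c + m' + b) = a + n + c + m' + b) :
    hcomp (whisker a f (c + n' + b)) (whisker (a + m + c) g b) h ≈ᵢ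
      hcomp (whisker (a + n + c) g b) (whisker a f (c + m' + b)) h' := by
  have hA : ∀ p, whisker a f (c + p + b) ≈ᵢ tensor (tensor (whisker a f c) (id p)) (id b) :=
    fun p => (whisker_add _ _ _ _).trans ((whisker_add _ _ _ _).tensor (.refl _))
  refine HIsotopic.trans (.hcomp (hA n') (.refl _) rfl) ?_
  refine HIsotopic.trans ?_ (HIsotopic.hcomp (.refl _) (hA m').symm _ (h := rfl))
  rw [hcomp_rfl, hcomp_rfl]
  refine (interchange _ _ _ _).trans (.trans ?_ (interchange _ _ _ _).symm)
  exact .tensor ((tensor_eq_comp _ _).symm.trans (tensor_eq_comp' _ _)) (.refl _)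

/-- The mirror image of a diagram in a horizontal line. -/
def flip : {m n : ℕ} → Diagram m n → Diagram n m
  | _, _, id n => id n
  | _, _, cup => cap
  | _, _, cap => cup
  | _, _, comp f g => comp (flip g) (flip f)
  | _, _, tensor f g => tensor (flip f) (flip g)

theorem flip_homCast {m n m' n' : ℕ} (hm : m = m') (hn : n = n') (t : Diagram m n) :
    flip (homCast hm hn t) = homCast hn hm (flip t) := by
  subst hm hn; rfl

/-- Reflection exchanges the two zigzags, whose signs differ, so it respects the moves only after
signs are forgotten. -/
theorem flip_move {m n : ℕ} {t t' : Diagram m n} {e : ℤˣ} (h : Move t e t') :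
    Isotopic (flip t) (flip t') := by
  cases h with
  | id_comp f => exact .move _ (.comp_id _)
  | comp_id f => exact .move _ (.id_comp _)
  | comp_assoc f g h => exact .symm (.move _ (.comp_assoc _ _ _))
  | tensor_id => exact .move _ (.tensor_id _ _)
  | tensor_assoc => rw [flip_homCast]; exact .move _ (.tensor_assoc _ _ _)
  | unit_tensor => rw [flip_homCast]; exact .move _ (.unit_tensor _)
  | tensor_unit => rw [flip_homCast]; exact .move _ (.tensor_unit _)
  | super_interchange f g h l => exact .move _ (.super_interchange _ _ _ _)
  | zigzag_left => exact .move _ .zigzag_right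
  | zigzag_right => exact .move _ .zigzag_left

theorem Isotopic.flip {m n : ℕ} {t t' : Diagram m n} (h : Isotopic t t') :
    Isotopic (flip t) (flip t') := by
  induction h with
  | refl => exact .refl _
  | symm _ h => exact h.symm
  | trans _ _ h h' => exact h.trans h'
  | move e h => exact flip_move h
  | comp _ _ h h' => exact h'.comp h
  | tensor _ _ h h' => exact h.tensor h'

theorem HIsotopic.flip {m n m' n' : ℕ} {t : Diagram m n} {t' : Diagram m' n'} (h : t ≈ᵢ t') :
    t.flip ≈ᵢ t'.flip := by
  obtain ⟨rfl, rfl, h⟩ := h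
  exact ⟨rfl, rfl, h.flip⟩

theorem flip_hcomp {l m m' n : ℕ} (f : Diagram m n) (g : Diagram l m') (h : m' = m) :
    flip (hcomp f g h) = hcomp (flip g) (flip f) h.symm := by
  subst h; rfl

/-! ### Reduction of every diagram to caps followed by cups. -/

/-- A cup between `a` strands on the left and `b` strands on the right. -/
abbrev cupAt (a b : ℕ) : Diagram (a + b) (a + 2 + b) := whisker a cup b

/-- A cap between `a` strands on the left and `b` strands on the right. -/
abbrev capAt (a b : ℕ) : Diagram (a + 2 + b) (a + b) := whisker a cap b

theorem capAt_cupAt (a b : ℕ) : HReduces 1 (comp (capAt a b) (cupAt a b)) (id (a + b)) := by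
  refine (whisker_comp _ _ _ _).symm.trans_hreduces ?_
  refine HReduces.trans_hisotopic ?_ (whisker_id a 0 b)
  have h := Reduces.tensor (.tensor (.isotopic (.refl (id a))) .bubble)
    (.isotopic (.refl (id b)))
  exact .of_reduces h

theorem capAt_cupAt_succ (a b : ℕ) (h : a + 1 + 2 + b = a + 2 + (b + 1)) :
    hcomp (capAt a (b + 1)) (cupAt (a + 1) b) h ≈ᵢ id (a + 1 + b) := by
  have hz : comp (m := 3) (tensor cap (id 1)) (tensor (id 1) cup) ≈ᵢ id 1 :=
    .of_move .zigzag_left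
  refine HIsotopic.trans ?_ ((whisker_congr rfl hz rfl).trans (whisker_id a 1 b))
  refine HIsotopic.trans ?_ (whisker_comp a b _ _).symm
  refine HIsotopic.hcomp ?_ ?_ rfl
  · rw [capAt, Nat.add_comm b 1]
    refine (whisker_add _ _ _ _).trans (.tensor (tensor_assoc _ _ _) (.refl _))
  · exact HIsotopic.tensor ((HIsotopic.tensor (tensor_id_id _ _).symm (.refl _)).trans
      (tensor_assoc _ _ _)) (.refl _)

theorem capAt_succ_cupAt (a b : ℕ) (h : a + 2 + (b + 1) = a + 1 + 2 + b) :
    hcomp (capAt (a + 1) b) (cupAt a (b + 1)) h ≈ᵢ id (a + 1 + b) := by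
  have := (capAt_cupAt_succ a b h.symm).flip
  rwa [flip_hcomp] at this

end Diagram

namespace Diagram

/-- Composites of cups with strands on both sides. -/
inductive IsCups (p : ℕ) : {n : ℕ} → Diagram p n → Prop
  | id : IsCups p (id p)
  | step {n : ℕ} {d : Diagram p n} (a b : ℕ) (h : n = a + b) :
      IsCups p d → IsCups p (hcomp (cupAt a b) d h)

theorem hcomp_swap {l m m' n m₁ m₁' m₂ m₂' k : ℕ} {f : Diagram m n} {g : Diagram l m'}
    {h : m' = m} {n₁ : ℕ} {g' : Diagram m₁ n₁} {f' : Diagram m₂ m₁'} {h₁ : m₁' = m₁}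
    {d : Diagram k m₂'}
    (e : m₂' = l) (e' : m₂' = m₂) (H : hcomp f g h ≈ᵢ hcomp g' f' h₁) :
    hcomp f (hcomp g d e) h ≈ᵢ hcomp g' (hcomp f' d e') h₁ :=
  (hcomp_assoc _ _ _ _ _).symm.trans
    ((HIsotopic.hcomp H (.refl d) e' (h := e)).trans (hcomp_assoc _ _ _ _ _))

theorem hcomp_cancel {l m m' n k m₂ : ℕ} {f : Diagram m n} {g : Diagram l m'}
    {h : m' = m} {d : Diagram k m₂} (e : m₂ = l) {j p : ℕ}
    (H : HReduces j (hcomp f g h) (id p)) : HReduces j (hcomp f (hcomp g d e) h) d := by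
  refine (hcomp_assoc _ _ _ _ _).symm.trans_hreduces ?_
  exact (HReduces.hcomp H (.refl d) (e.trans H.1)).trans_hisotopic (id_hcomp _ _)

theorem HReduces.hcomp_right {j l m m' n l₁ m₁' : ℕ} (f : Diagram m n) {g : Diagram l m'}
    {h : m' = m} {g₁ : Diagram l₁ m₁'} (hg : HReduces j g g₁) (h₁ : m₁' = m) :
    HReduces j (Diagram.hcomp f g h) (Diagram.hcomp f g₁ h₁) := by
  simpa using HReduces.hcomp (.refl f) hg h₁

theorem IsCups.exists_hcomp {m n n' p : ℕ} {c : Diagram m n} {d : Diagram n' p} (hc : IsCups m c)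
    (hd : IsCups n' d) (h : n = n') : ∃ e : Diagram m p, IsCups m e ∧ hcomp d c h ≈ᵢ e := by
  induction hd with
  | id => subst h; exact ⟨c, hc, id_hcomp _ _⟩
  | step a b h' _ ih =>
    obtain ⟨e, he, hi⟩ := ih
    exact ⟨_, he.step a b h', (hcomp_assoc _ _ _ _ _).trans (.hcomp (.refl _) hi _)⟩

/-- The cap at `a` sinks through the stack, meeting its top cup at `i`. If `a` and `i` differ by at
least `2`, the two commute and the cap sinks further; if they differ by `1`, a zigzag cancels both;
if `a = i`, they form a circle. The second alternative is a cap that reaches the bottom. -/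
theorem IsCups.capAt_hcomp {p n : ℕ} {d : Diagram p n} (hd : IsCups p d) :
    ∀ (a b : ℕ) (h : n = a + 2 + b),
      (∃ (j n' : ℕ) (d' : Diagram p n'), IsCups p d' ∧
        HReduces j (hcomp (capAt a b) d h) d') ∨
      (∃ (j a' b' n' : ℕ) (d' : Diagram (a' + b') n'), IsCups (a' + b') d' ∧
        HReduces j (hcomp (capAt a b) d h) (comp d' (capAt a' b'))) := by
  induction hd with
  | id =>
    intro a b h
    subst h
    exact .inr ⟨0, a, b, _, Diagram.id _, .id,
      ((hcomp_id _ _).trans (id_hcomp _ rfl).symm).hreduces⟩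
  | @step n₀ d₀ i k h₀ hd₀ ih =>
    intro a b h
    -- The commuting case: `i', k'` and `a', b'` are the positions of the cup and the cap after they
    -- have changed places.
    have key : ∀ (i' k' a' b' : ℕ) (h₁ : n₀ = a' + 2 + b') (h₂ : a' + b' = i' + k'),
        hcomp (capAt a b) (hcomp (cupAt i k) d₀ h₀) h ≈ᵢ
          hcomp (cupAt i' k') (hcomp (capAt a' b') d₀ h₁) h₂ →
        (∃ (j n' : ℕ) (d' : Diagram p n'), IsCups p d' ∧
          HReduces j (hcomp (capAt a b) (hcomp (cupAt i k) d₀ h₀) h) d') ∨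
        (∃ (j a' b' n' : ℕ) (d' : Diagram (a' + b') n'), IsCups (a' + b') d' ∧
          HReduces j (hcomp (capAt a b) (hcomp (cupAt i k) d₀ h₀) h)
            (comp d' (capAt a' b'))) := by
      intro i' k' a' b' h₁ h₂ H
      rcases ih a' b' h₁ with ⟨j, n', d', hd', hr⟩ | ⟨j, a'', b'', n', d', hd', hr⟩
      · refine .inl ⟨j, _, _, hd'.step i' k' (hr.2.1.symm.trans h₂), H.trans_hreduces ?_⟩
        exact .hcomp_right _ hr _
      · refine .inr ⟨j, a'', b'', _, _, hd'.step i' k' (hr.2.1.symm.trans h₂),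
          H.trans_hreduces ?_⟩
        refine HReduces.trans_hisotopic ?_ (hcomp_assoc _ _ _ _ rfl).symm
        exact .hcomp_right _ hr _
    rcases lt_trichotomy a i with hlt | rfl | hlt
    · rcases Nat.lt_or_ge (a + 1) i with hlt' | hge
      · obtain ⟨c, rfl⟩ := Nat.exists_eq_add_of_le (show a + 2 ≤ i from hlt')
        obtain rfl : b = c + 2 + k := by omega
        exact key (a + c) k a (c + k) (by omega) (by omega)
          (hcomp_swap _ _ (whisker_comm a c k cap cup (by omega) (by omega)))
      · obtain rfl : i = a + 1 := by omega
        obtain rfl : b = k + 1 := by omega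
        exact .inl ⟨0, _, d₀, hd₀, hcomp_cancel _ (capAt_cupAt_succ a k _).hreduces⟩
    · obtain rfl : b = k := by omega
      exact .inl ⟨1, _, d₀, hd₀, hcomp_cancel _ (capAt_cupAt a b)⟩
    · rcases Nat.lt_or_ge (i + 1) a with hlt' | hge
      · obtain ⟨c, rfl⟩ := Nat.exists_eq_add_of_le (show i + 2 ≤ a from hlt')
        obtain rfl : k = c + 2 + b := by omega
        exact key i (c + b) (i + c) b (by omega) (by omega)
          (hcomp_swap _ _ (whisker_comm i c b cup cap (by omega) (by omega)).symm)
      · obtain rfl : a = i + 1 := by omega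
        obtain rfl : k = b + 1 := by omega
        exact .inl ⟨0, _, d₀, hd₀, hcomp_cancel _ (capAt_succ_cupAt i b _).hreduces⟩

/-- A diagram that reduces to a composite of caps followed by a composite of cups. -/
def ReducesToCapsCups {m n : ℕ} (t : Diagram m n) : Prop :=
  ∃ (j p m' n' : ℕ) (c : Diagram p n') (d : Diagram p m'), IsCups p c ∧ IsCups p d ∧
    HReduces j t (comp c d.flip)

theorem ReducesToCapsCups.of_hisotopic {m n m' n' : ℕ} {t : Diagram m n} {t' : Diagram m' n'}
    (ht : ReducesToCapsCups t) (h : t' ≈ᵢ t) : ReducesToCapsCups t' := by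
  obtain ⟨j, p, m'', n'', c, d, hc, hd, hr⟩ := ht
  exact ⟨j, p, m'', n'', c, d, hc, hd, h.trans_hreduces hr⟩

theorem ReducesToCapsCups.cupAt_hcomp {m n : ℕ} {t : Diagram m n} (ht : ReducesToCapsCups t)
    (a b : ℕ) (h : n = a + b) : ReducesToCapsCups (hcomp (cupAt a b) t h) := by
  obtain ⟨j, p, m', n', c, d, hc, hd, hr⟩ := ht
  refine ⟨j, p, m', _, _, d, hc.step a b (hr.2.1.symm.trans h), hd, ?_⟩
  refine HReduces.trans_hisotopic ?_ (hcomp_assoc _ _ _ _ rfl).symm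
  exact .hcomp_right _ hr _

theorem ReducesToCapsCups.capAt_hcomp {m n : ℕ} {t : Diagram m n} (ht : ReducesToCapsCups t)
    (a b : ℕ) (h : n = a + 2 + b) : ReducesToCapsCups (hcomp (capAt a b) t h) := by
  obtain ⟨i, p, m', n', c, d, hc, hd, hr⟩ := ht
  have h' := hr.2.1.symm.trans h
  have hr' : HReduces i (hcomp (capAt a b) t h) (comp (hcomp (capAt a b) c h') d.flip) := by
    refine HReduces.trans_hisotopic ?_ (hcomp_assoc _ _ _ _ rfl).symm
    exact .hcomp_right _ hr _
  rcases hc.capAt_hcomp a b h' with ⟨j, n'', c', hc', hj⟩ | ⟨j, a', b', n'', c', hc', hj⟩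
  · exact ⟨i + (j + 0), p, m', n'', c', d, hc', hd, hr'.trans
      (HReduces.hcomp (h := rfl) hj (.refl _) rfl)⟩
  · obtain ⟨e, he, hi⟩ := (IsCups.id.step a' b' rfl).exists_hcomp hd hj.1.symm
    refine ⟨i + (j + 0), _, m', n'', c', e, hc', he, hr'.trans ?_⟩
    refine (HReduces.hcomp (h := rfl) hj (.refl _) hj.1).trans_hisotopic ?_
    refine (hcomp_assoc _ _ _ rfl _).trans (.hcomp (.refl _) ?_ rfl)
    refine HIsotopic.trans ?_ hi.flip
    rw [flip_hcomp, flip_hcomp]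
    exact .hcomp (id_hcomp _ _).symm (.refl _) _

/-- The added strands on both sides are what makes the induction close: a tensor product is a
composite of two whiskered factors, which are attached to `t` one after the other. -/
theorem ReducesToCapsCups.whisker_hcomp {m n : ℕ} (f : Diagram m n) :
    ∀ {l n' : ℕ} {t : Diagram l n'}, ReducesToCapsCups t → ∀ (a b : ℕ) (h : n' = a + m + b),
      ReducesToCapsCups (hcomp (whisker a f b) t h) := by
  induction f with
  | id n =>
    intro l n' t ht a b h
    exact ht.of_hisotopic
      ((HIsotopic.hcomp (whisker_id a n b) (.refl t) h).trans (id_hcomp _ _))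
  | cup => intro l n' t ht a b h; exact ht.cupAt_hcomp a b h
  | cap => intro l n' t ht a b h; exact ht.capAt_hcomp a b h
  | comp f g hf hg =>
    intro l n' t ht a b h
    refine (hf (hg ht a b h) a b rfl).of_hisotopic ?_
    exact (HIsotopic.hcomp (whisker_comp a b f g) (.refl t) h).trans
      (hcomp_assoc _ _ _ rfl _)
  | @tensor p q r s f g hf hg =>
    intro l n' t ht a b h
    refine (hf (hg ht (a + p) b (by omega)) a (s + b) (by omega)).of_hisotopic ?_
    refine HIsotopic.trans ?_ (hcomp_assoc _ _ _ (by omega) _)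
    refine HIsotopic.hcomp ?_ (.refl t) (by omega)
    refine (whisker_congr rfl (tensor_eq_comp f g) rfl).trans ?_
    refine (whisker_comp _ _ _ _).trans ?_
    refine HIsotopic.hcomp (h := rfl) ?_ ?_ (by omega)
    · refine HIsotopic.trans ?_ (whisker_add a s b f).symm
      exact .tensor (tensor_assoc _ _ _).symm (.refl _)
    · exact .tensor ((tensor_assoc _ _ _).symm.trans
        (.tensor (tensor_id_id _ _) (.refl _))) (.refl _)

theorem reducesToCapsCups {m n : ℕ} (t : Diagram m n) : ReducesToCapsCups t := by
  have h : ReducesToCapsCups (id m) :=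
    ⟨0, m, m, m, id m, id m, .id, .id, (id_hcomp (id m) rfl).symm.hreduces⟩
  refine (h.whisker_hcomp t 0 0 (by omega)).of_hisotopic ?_
  exact ((hcomp_id _ _).trans (whisker_zero_zero t)).symm

/-! ### Sorting the cups; the word that determines a sorted composite. -/

/-- Composites of cups whose positions are increasing. In `NormalCups p k u d`, the number `k`
bounds the positions of the cups, and `u` is the word on the top boundary in which the left end
of each cup is `false` and its right end is `true`, as are the ends of the other strands. -/
inductive NormalCups (p : ℕ) : {n : ℕ} → ℕ → List Bool → Diagram p n → Prop
  | id : NormalCups p 0 (List.replicate p true) (id p)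
  | step {n k : ℕ} {u : List Bool} {d : Diagram p n} (a b : ℕ) (h : n = a + b) (hk : k ≤ a) :
      NormalCups p k u d → NormalCups p (a + 1) (u.take a ++ false :: true :: u.drop a)
        (hcomp (cupAt a b) d h)

theorem NormalCups.length_eq {p n k : ℕ} {u : List Bool} {d : Diagram p n}
    (h : NormalCups p k u d) : u.length = n := by
  induction h with
  | id => simp
  | step a b h hk _ ih => simp [ih, h]; omega

/-- When there are cups, the last `false` of the word sits at position `k - 1`, the left end of the
topmost cup. This lets the last cup be read off from the word. -/
theorem NormalCups.drop_eq {p n k : ℕ} {u : List Bool} {d : Diagram p n}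
    (h : NormalCups p k u d) : ∀ i (hi : i < u.length), k ≤ i → u[i] = true := by
  cases h with
  | id => simp
  | @step n k u d a b h hk hd =>
    intro i hi hai
    have hl := hd.length_eq
    have ih := hd.drop_eq
    simp only [List.length_append, List.length_take, List.length_cons, List.length_drop] at hi
    obtain ⟨c, rfl⟩ := Nat.exists_eq_add_of_le hai
    rw [List.getElem_append_right (by simp; omega)]
    have : a + 1 + c - (List.take a u).length = c + 1 := by simp; omega
    simp only [this, List.getElem_cons_succ]
    cases c with
    | zero => simp
    | succ c =>
      simp only [List.getElem_cons_succ, List.getElem_drop]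
      exact ih _ _ (by omega)

/-- Insertion sort: a cup at `a ≤ i` slides below the top cup, whose position becomes `i + 2`. The
bound on `k'` guarantees that the shifted cup still lies beyond the positions of all those below it.
-/
theorem NormalCups.cupAt_hcomp {p n k : ℕ} {u : List Bool} {d : Diagram p n}
    (hd : NormalCups p k u d) : ∀ (a b : ℕ) (h : n = a + b),
      ∃ (n' k' : ℕ) (u' : List Bool) (d' : Diagram p n'), NormalCups p k' u' d' ∧
        hcomp (cupAt a b) d h ≈ᵢ d' ∧ k' ≤ max (k + 2) (a + 1) := by
  induction hd with
  | id => exact fun a b h => ⟨_, _, _, _, .step a b h (Nat.zero_le _) .id, .refl _, by omega⟩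
  | @step n₀ k₀ u₀ d₀ i k h₀ hk hd₀ ih =>
    intro a b h
    rcases Nat.lt_or_ge i a with hlt | hge
    · exact ⟨_, _, _, _, .step a b h hlt (.step i k h₀ hk hd₀), .refl _, by omega⟩
    · obtain ⟨c, rfl⟩ := Nat.exists_eq_add_of_le hge
      obtain rfl : b = c + 2 + k := by omega
      obtain ⟨n', k', u', d', hd', hi, hk'⟩ := ih a (c + k) (by omega)
      have hn : n' = a + 2 + c + k := by have := hi.2.1; omega
      refine ⟨_, _, _, _, .step (a + 2 + c) k hn (by omega) hd', ?_, by omega⟩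
      have h' : n₀ = a + (c + k) := by omega
      have h'' : a + 2 + (c + k) = a + 2 + c + k := by omega
      have H : hcomp (cupAt a (c + 2 + k)) (hcomp (cupAt (a + c) k) d₀ h₀) h ≈ᵢ
          hcomp (cupAt (a + 2 + c) k) (hcomp (cupAt a (c + k)) d₀ h') h'' :=
        hcomp_swap h₀ h' (whisker_comm a c k cup cup h h'')
      refine H.trans ?_
      exact .hcomp (.refl _) hi _

theorem IsCups.exists_normalCups {p n : ℕ} {d : Diagram p n} (hd : IsCups p d) :
    ∃ (k : ℕ) (u : List Bool) (d' : Diagram p n), NormalCups p k u d' ∧ d ≈ᵢ d' := by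
  induction hd with
  | id => exact ⟨_, _, _, .id, .refl _⟩
  | step a b h _ ih =>
    obtain ⟨k, u, d', hd', hi⟩ := ih
    obtain ⟨n', k', u', d'', hd'', hi', -⟩ := hd'.cupAt_hcomp a b h
    obtain rfl := hi'.2.1
    exact ⟨k', u', d'', hd'', (HIsotopic.hcomp (.refl _) hi h).trans hi'⟩

/-- The last `false` of the word gives the position of the topmost cup. Deleting it together with
the following `true` leaves the word of the remaining cups, and induction applies. -/
theorem NormalCups.unique {p n k : ℕ} {u : List Bool} {d : Diagram p n}
    (hd : NormalCups p k u d) : ∀ {n' k' : ℕ} {u' : List Bool} {d' : Diagram p n'},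
      NormalCups p k' u' d' → u = u' → ∃ h : n = n', homCast rfl h d = d' := by
  induction hd with
  | id =>
    intro n' k' u' d' hd' hu
    cases hd' with
    | id => exact ⟨rfl, rfl⟩
    | step a b h hk hd' =>
      have : false ∈ List.replicate p true := by rw [hu]; simp
      simp at this
  | @step n₀ k₀ u₀ d₀ i k h₀ hk hd₀ ih =>
    intro n' k' u' d' hd' hu
    cases hd' with
    | id =>
      have : false ∈ List.replicate p true := by rw [← hu]; simp
      simp at this
    | @step n₁ k₁ u₁ d₁ i₁ k₂ h₁ hk₁ hd₁ =>
      have hl := hd₀.length_eq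
      have hl₁ := hd₁.length_eq
      -- The common word has `false` at `i'`, while all its letters beyond `i` are `true`. Used in
      -- both directions, this gives `i = i₁`.
      have aux : ∀ {n n' l l' i i' : ℕ} {u u' : List Bool} {d : Diagram p n}
          {d' : Diagram p n'}, NormalCups p l u d → NormalCups p l' u' d' → l ≤ i → l' ≤ i' →
          i ≤ n → i' ≤ n' →
          u.take i ++ false :: true :: u.drop i = u'.take i' ++ false :: true :: u'.drop i' →
          i' ≤ i := by
        intro n n' l l' i i' u u' d d' hd hd' hl hl' hi hi' hu
        have e : (u.take i ++ false :: true :: u.drop i)[i']? = some false := by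
          rw [hu, List.getElem?_append_right (by simp)]
          simp [hd'.length_eq, hi']
        by_contra hlt
        obtain ⟨hlt', e'⟩ := List.getElem?_eq_some_iff.1 e
        have := (NormalCups.step i (n - i) (by omega) hl hd).drop_eq i' hlt' (by omega)
        rw [e'] at this
        cases this
      obtain rfl : i = i₁ := le_antisymm
        (aux hd₁ hd₀ hk₁ hk (by omega) (by omega) hu.symm)
        (aux hd₀ hd₁ hk hk₁ (by omega) (by omega) hu)
      obtain ⟨e₁, e₂⟩ := List.append_inj hu (by simp; omega)
      have hu' : u₀ = u₁ := by
        rw [← List.take_append_drop i u₀, ← List.take_append_drop i u₁, e₁]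
        simp at e₂
        rw [e₂]
      obtain ⟨rfl, e⟩ := ih hd₁ hu'
      obtain rfl : k = k₂ := by omega
      refine ⟨rfl, ?_⟩
      rw [← e]; rfl

end Diagram

/-! ### Leading terms and weights of the matrices of normal diagrams. -/

namespace StringModel

open Diagram

section Semiring

variable {R : Type*} [CommSemiring R] (M : StringModel R)

theorem eval_hcomp {l m m' n : ℕ} (f : Diagram m n) (g : Diagram l m') (h : m' = m)
    (x y : List Bool) :
    M.eval (hcomp f g h) x y = ∑ z ∈ words m, M.eval f x z * M.eval g z y := by
  subst h; rfl

/-- The strands beside the cup act as identities, so only the term with middle word `x ++ x'`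
survives. This peels the topmost cup off an entry. -/
theorem eval_hcomp_cupAt {l n a b : ℕ} (d : Diagram l n) (h : n = a + b) {x x' : List Bool}
    (hx : x.length = a) (hx' : x'.length = b) (r s : Bool) (y : List Bool) :
    M.eval (hcomp (cupAt a b) d h) (x ++ r :: s :: x') y =
      M.sgn ^ oddCount x * M.cup r s * M.eval d (x ++ x') y := by
  rw [eval_hcomp, sum_words_add, Finset.sum_eq_single x,
    Finset.sum_eq_single x']
  · rw [show x ++ r :: s :: x' = (x ++ [r, s]) ++ x' by simp,
      show M.eval (cupAt a b) = M.eval (.tensor (.tensor (.id a) .cup) (.id b)) from rfl,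
      M.eval_tensor_append _ _ (by simp [hx]) (by simp [hx]),
      show M.eval (.tensor (.id a) .cup) (x ++ [r, s]) x =
        M.eval (.tensor (.id a) .cup) (x ++ [r, s]) (x ++ []) by simp,
      M.eval_tensor_append _ _ hx hx]
    simp [degree, eval, cupWord]
  · intro z hz hne
    rw [show x ++ r :: s :: x' = (x ++ [r, s]) ++ x' by simp,
      show M.eval (cupAt a b) = M.eval (.tensor (.tensor (.id a) .cup) (.id b)) from rfl,
      M.eval_tensor_append _ _ (by simp [hx]) (by simp [hx])]
    simp [eval_id, hne.symm]
  · intro h; exact absurd (mem_words.2 hx') h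
  · intro z hz hne
    rw [mem_words] at hz
    refine Finset.sum_eq_zero fun z' hz' => ?_
    rw [show x ++ r :: s :: x' = (x ++ [r, s]) ++ x' by simp,
      show M.eval (cupAt a b) = M.eval (.tensor (.tensor (.id a) .cup) (.id b)) from rfl,
      M.eval_tensor_append _ _ (by simp [hx]) (by simp [hz]),
      show M.eval (.tensor (.id a) .cup) (x ++ [r, s]) z =
        M.eval (.tensor (.id a) .cup) (x ++ [r, s]) (z ++ []) by simp,
      M.eval_tensor_append _ _ hx hz]
    simp [eval_id, hne.symm]
  · intro h; exact absurd (mem_words.2 hx) h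

theorem eval_hcomp_capAt {l n a b : ℕ} (d : Diagram n l) (h : a + b = n) {x x' : List Bool}
    (hx : x.length = a) (hx' : x'.length = b) (r s : Bool) (y : List Bool) :
    M.eval (hcomp d (capAt a b) h) y (x ++ r :: s :: x') =
      M.sgn ^ oddCount x * M.cap r s * M.eval d y (x ++ x') := by
  subst h
  rw [eval_hcomp, sum_words_add, Finset.sum_eq_single x,
    Finset.sum_eq_single x']
  · rw [show x ++ r :: s :: x' = (x ++ [r, s]) ++ x' by simp,
      show M.eval (capAt a b) = M.eval (.tensor (.tensor (.id a) .cap) (.id b)) from rfl,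
      M.eval_tensor_append _ _ (by simp [hx]) (by simp [hx]),
      show M.eval (.tensor (.id a) .cap) x (x ++ [r, s]) =
        M.eval (.tensor (.id a) .cap) (x ++ []) (x ++ [r, s]) by simp,
      M.eval_tensor_append _ _ hx hx]
    simp [degree, eval, capWord, mul_comm]
  · intro z hz hne
    rw [show x ++ r :: s :: x' = (x ++ [r, s]) ++ x' by simp,
      show M.eval (capAt a b) = M.eval (.tensor (.tensor (.id a) .cap) (.id b)) from rfl,
      M.eval_tensor_append _ _ (by simp [hx]) (by simp [hx])]
    simp [eval_id, hne]
  · intro h; exact absurd (mem_words.2 hx') h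
  · intro z hz hne
    rw [mem_words] at hz
    refine Finset.sum_eq_zero fun z' hz' => ?_
    rw [show x ++ r :: s :: x' = (x ++ [r, s]) ++ x' by simp,
      show M.eval (capAt a b) = M.eval (.tensor (.tensor (.id a) .cap) (.id b)) from rfl,
      M.eval_tensor_append _ _ (by simp [hz]) (by simp [hx]),
      show M.eval (.tensor (.id a) .cap) z (x ++ [r, s]) =
        M.eval (.tensor (.id a) .cap) (z ++ []) (x ++ [r, s]) by simp,
      M.eval_tensor_append _ _ hz hx]
    simp [eval_id, hne]
  · intro h; exact absurd (mem_words.2 hx) h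

/-- The parity of the degree is carried through the induction because the tensor case needs it. -/
theorem isotopic_scales {m n : ℕ} {t t' : Diagram m n} (h : Isotopic t t') :
    (t.degree : ZMod 2) = t'.degree ∧ ∃ e : ℤˣ, M.Scales t (M.χ e) t' := by
  induction h with
  | refl t => exact ⟨rfl, 1, by simpa using Scales.refl M t⟩
  | symm _ h =>
    obtain ⟨hd, e, h⟩ := h
    refine ⟨hd.symm, e, fun x y hx hy => ?_⟩
    rw [h x y hx hy, ← mul_assoc, ← map_mul, Int.units_mul_self, map_one, one_mul]
  | trans _ _ h h' =>
    obtain ⟨hd, e, h⟩ := h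
    obtain ⟨hd', e', h'⟩ := h'
    refine ⟨hd.trans hd', e * e', fun x y hx hy => ?_⟩
    rw [h x y hx hy, h' x y hx hy, map_mul, mul_assoc]
  | move e h => exact ⟨STL.degree_move h, e, fun x y hx hy => M.eval_move h hx hy⟩
  | comp _ _ h h' =>
    obtain ⟨hd, e, h⟩ := h
    obtain ⟨hd', e', h'⟩ := h'
    exact ⟨by simp [degree, hd, hd'], e * e', by rw [map_mul]; exact h.comp M h'⟩
  | tensor _ _ h h' =>
    obtain ⟨hd, e, h⟩ := h
    obtain ⟨hd', e', h'⟩ := h'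
    exact ⟨by simp [degree, hd, hd'], e * e', by rw [map_mul]; exact h.tensor M h' hd'⟩

theorem reduces_scales {j m n : ℕ} {t t' : Diagram m n} (h : Reduces j t t') :
    (t.degree : ZMod 2) = t'.degree ∧ ∃ e : ℤˣ, M.Scales t (M.χ e * M.bubble ^ j) t' := by
  induction h with
  | isotopic h => simpa using M.isotopic_scales h
  | bubble =>
    exact ⟨rfl, 1, fun x y hx hy => by rw [M.eval_bubble hx hy, map_one, one_mul, pow_one]⟩
  | trans _ _ h h' =>
    obtain ⟨hd, e, h⟩ := h
    obtain ⟨hd', e', h'⟩ := h'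
    refine ⟨hd.trans hd', e * e', fun x y hx hy => ?_⟩
    rw [h x y hx hy, h' x y hx hy, map_mul]; ring
  | comp _ _ h h' =>
    obtain ⟨hd, e, h⟩ := h
    obtain ⟨hd', e', h'⟩ := h'
    refine ⟨by simp [degree, hd, hd'], e * e', ?_⟩
    rw [map_mul, pow_add, mul_mul_mul_comm]; exact h.comp M h'
  | tensor _ _ h h' =>
    obtain ⟨hd, e, h⟩ := h
    obtain ⟨hd', e', h'⟩ := h'
    refine ⟨by simp [degree, hd, hd'], e * e', ?_⟩
    rw [map_mul, pow_add, mul_mul_mul_comm]; exact h.tensor M h' hd'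

end Semiring

theorem exists_append_cons_cons {a b : ℕ} {x : List Bool} (h : x.length = a + 2 + b) :
    ∃ y r s z, x = y ++ r :: s :: z ∧ y.length = a ∧ z.length = b := by
  obtain ⟨w, z, rfl, hw, hz⟩ := exists_append_of_length h
  obtain ⟨y, v, rfl, hy, hv⟩ := exists_append_of_length hw
  obtain ⟨r, s, rfl⟩ := List.length_eq_two.1 hv
  exact ⟨y, r, s, z, by simp, hy, hz⟩

/-- A word, read as a binary number. -/
def binaryValue : List Bool → ℕ
  | [] => 0
  | b :: x => (if b then 2 ^ x.length else 0) + binaryValue x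

theorem binaryValue_lt (x : List Bool) : binaryValue x < 2 ^ x.length := by
  induction x with
  | nil => simp [binaryValue]
  | cons b x ih =>
    rw [binaryValue, List.length_cons, pow_succ]
    split_ifs <;> omega

theorem eq_of_binaryValue_eq {x y : List Bool} (h : x.length = y.length)
    (h' : binaryValue x = binaryValue y) : x = y := by
  induction x generalizing y with
  | nil => exact (List.length_eq_zero_iff.1 h.symm).symm
  | cons a x ih =>
    cases y with
    | nil => simp at h
    | cons b y =>
      have hl : x.length = y.length := by simpa using h
      have hx := binaryValue_lt x
      have hy := binaryValue_lt y
      rw [hl] at hx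
      cases a <;> cases b <;> simp [binaryValue, hl] at h' ⊢ <;> first | exact ih hl h' | omega

/-- For words of equal length, comparing binary values is lexicographic comparison. Of the two
insertions `r ≠ s`, the one with `false` first is the smaller. This is the inductive step for
leading terms. -/
theorem binaryValue_insert_le {x x' y y' : List Bool} (hx : x.length = y.length)
    (hx' : x'.length = y'.length) (h : binaryValue (x ++ x') ≤ binaryValue (y ++ y'))
    {r s : Bool} (hrs : r ≠ s) :
    binaryValue (x ++ false :: true :: x') ≤ binaryValue (y ++ r :: s :: y') := by
  induction x generalizing y with
  | nil =>
    obtain rfl := List.length_eq_zero_iff.1 hx.symm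
    cases r <;> cases s <;> simp [binaryValue, hx'] at h hrs ⊢
    · exact h
    · have := Nat.one_le_two_pow (n := y'.length)
      rw [pow_succ]; omega
  | cons a x ih =>
    cases y with
    | nil => simp at hx
    | cons b y =>
      have hl : x.length = y.length := by simpa using hx
      have h₁ := binaryValue_lt (y ++ y')
      have h₂ := binaryValue_lt (x ++ false :: true :: x')
      have h₃ := ih hl
      rw [List.cons_append, List.cons_append] at h ⊢
      simp only [binaryValue, List.length_append, List.length_cons, hl, hx'] at *
      cases a <;> cases b <;> simp at h ⊢
      · exact h₃ h
      · omega
      · omega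
      · exact h₃ h

section Semiring

variable {R : Type*} [CommSemiring R] (M : StringModel R)

/-- Each cup inserts two different letters, and `u` always inserts `false, true`, the smaller
choice; hence `u` is a lower bound for the support. -/
theorem binaryValue_le_of_eval_ne_zero (hcup : ∀ r s, M.cup r s ≠ 0 ↔ r ≠ s) {p n k : ℕ}
    {u : List Bool} {d : Diagram p n} (hd : NormalCups p k u d) : ∀ {x : List Bool},
    x.length = n → M.eval d x (List.replicate p true) ≠ 0 → binaryValue u ≤ binaryValue x := by
  induction hd with
  | id =>
    intro x _ h
    simp only [eval_id, ne_eq, ite_eq_right_iff, not_forall] at h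
    rw [h.1]
  | @step n k u d a b h hk hd ih =>
    intro x hx hne
    obtain ⟨y, r, s, z, rfl, hy, hz⟩ := exists_append_cons_cons hx
    rw [M.eval_hcomp_cupAt d h hy hz] at hne
    have hl := hd.length_eq
    refine binaryValue_insert_le (by simp [hl]; omega) (by simp [hl]; omega) ?_
      ((hcup _ _).1 (right_ne_zero_of_mul (left_ne_zero_of_mul hne)))
    rw [List.take_append_drop]
    exact ih (by simp; omega) (right_ne_zero_of_mul hne)

/-- Conservation of weight: a cup creates one `true` and one `false`. -/
theorem count_of_eval_ne_zero (hcup : ∀ r s, M.cup r s ≠ 0 ↔ r ≠ s) {p n k : ℕ}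
    {u : List Bool} {d : Diagram p n} (hd : NormalCups p k u d) : ∀ {x y : List Bool},
    x.length = n → M.eval d x y ≠ 0 → 2 * x.count true + p = 2 * y.count true + n := by
  induction hd with
  | id =>
    intro x y _ h
    simp only [eval_id, ne_eq, ite_eq_right_iff, not_forall] at h
    rw [h.1]
  | @step n k u d a b h hk hd ih =>
    intro x w hx hne
    obtain ⟨y, r, s, z, rfl, hy, hz⟩ := exists_append_cons_cons hx
    rw [M.eval_hcomp_cupAt d h hy hz] at hne
    have hrs := (hcup _ _).1 (right_ne_zero_of_mul (left_ne_zero_of_mul hne))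
    have := ih (by simp; omega) (right_ne_zero_of_mul hne)
    cases r <;> cases s <;> simp at hrs this ⊢ <;> omega

end Semiring

section Domain

variable {R : Type*} [CommRing R] [IsDomain R] (M : StringModel R)

theorem sgn_pow_ne_zero (a : ℕ) : M.sgn ^ a ≠ 0 :=
  pow_ne_zero _ (left_ne_zero_of_mul_eq_one M.sgn_mul_sgn)

theorem eval_normalCups_ne_zero (hcup : ∀ r s, M.cup r s ≠ 0 ↔ r ≠ s) {p n k : ℕ}
    {u : List Bool} {d : Diagram p n} (hd : NormalCups p k u d) :
    M.eval d u (List.replicate p true) ≠ 0 := by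
  induction hd with
  | id => simp [eval_id]
  | @step n k u d a b h hk hd ih =>
    rw [M.eval_hcomp_cupAt d h (by simp [hd.length_eq]; omega) (by simp [hd.length_eq]; omega),
      List.take_append_drop]
    exact mul_ne_zero (mul_ne_zero (M.sgn_pow_ne_zero _) ((hcup _ _).2 (by simp))) ih

/-- Reflection replaces cup entries by cap entries with the same support, so statements about
supports of cups carry over to caps. -/
theorem eval_flip_ne_zero_iff (hcup : ∀ r s, M.cup r s ≠ 0 ↔ r ≠ s)
    (hcap : ∀ r s, M.cap r s ≠ 0 ↔ r ≠ s) {p n k : ℕ}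
    {u : List Bool} {d : Diagram p n} (hd : NormalCups p k u d) : ∀ {x y : List Bool},
    x.length = n → (M.eval d.flip y x ≠ 0 ↔ M.eval d x y ≠ 0) := by
  induction hd with
  | id => intro x y _; simp [Diagram.flip, eval_id, eq_comm]
  | @step n k u d a b h hk hd ih =>
    intro x w hx
    obtain ⟨y, r, s, z, rfl, hy, hz⟩ := exists_append_cons_cons hx
    rw [M.eval_hcomp_cupAt d h hy hz, flip_hcomp]
    change M.eval (hcomp d.flip (capAt a b) h.symm) _ _ ≠ 0 ↔ _
    rw [M.eval_hcomp_capAt _ _ hy hz, mul_ne_zero_iff, mul_ne_zero_iff, mul_ne_zero_iff,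
      mul_ne_zero_iff, hcup, hcap, ih (by simp; omega)]

/-- A nonzero entry passes through some middle word of length `p`, whose weight is that of `x`,
namely `p'`. So `p' ≤ p`, and equality forces the all-`true` middle word, for which the lower bounds
on the supports apply. -/
theorem exists_of_eval_comp_ne_zero (hcup : ∀ r s, M.cup r s ≠ 0 ↔ r ≠ s)
    (hcap : ∀ r s, M.cap r s ≠ 0 ↔ r ≠ s) {p m n k l : ℕ} {u v : List Bool}
    {c : Diagram p n} {d : Diagram p m} (hc : NormalCups p k u c) (hd : NormalCups p l v d)
    {x y : List Bool} (hx : x.length = n) (hy : y.length = m) {p' : ℕ}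
    (hx' : 2 * x.count true = p' + n) (h : M.eval (comp c d.flip) x y ≠ 0) :
    p' ≤ p ∧ (p' = p → binaryValue u ≤ binaryValue x ∧ binaryValue v ≤ binaryValue y) := by
  rw [eval_comp] at h
  obtain ⟨z, hz, hne⟩ := Finset.exists_ne_zero_of_sum_ne_zero h
  rw [mem_words] at hz
  have h₁ := left_ne_zero_of_mul hne
  have h₂ := right_ne_zero_of_mul hne
  rw [M.eval_flip_ne_zero_iff hcup hcap hd hy] at h₂
  have hcount := M.count_of_eval_ne_zero hcup hc hx h₁
  have hle := List.count_le_length (a := true) (l := z)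
  refine ⟨by omega, fun hp => ?_⟩
  have hz' : z = List.replicate p true := by
    rw [List.eq_replicate_iff]
    refine ⟨hz, fun b hb => ((List.count_eq_length.1 (by omega)) b hb).symm⟩
  subst hz'
  exact ⟨M.binaryValue_le_of_eval_ne_zero hcup hc hx h₁,
    M.binaryValue_le_of_eval_ne_zero hcup hd hy h₂⟩

/-- At `u, v` the weight is the maximal one, so only the all-`true` middle word contributes and
nothing can cancel. -/
theorem eval_comp_flip_ne_zero (hcup : ∀ r s, M.cup r s ≠ 0 ↔ r ≠ s)
    (hcap : ∀ r s, M.cap r s ≠ 0 ↔ r ≠ s) {p m n k l : ℕ} {u v : List Bool}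
    {c : Diagram p n} {d : Diagram p m} (hc : NormalCups p k u c) (hd : NormalCups p l v d) :
    2 * u.count true = p + n ∧ M.eval (comp c d.flip) u v ≠ 0 := by
  have h₁ := M.eval_normalCups_ne_zero hcup hc
  have h₂ := M.eval_normalCups_ne_zero hcup hd
  have hcount := M.count_of_eval_ne_zero hcup hc hc.length_eq h₁
  rw [List.count_replicate_self] at hcount
  refine ⟨by omega, ?_⟩
  rw [eval_comp, Finset.sum_eq_single (List.replicate p true)]
  · exact mul_ne_zero h₁ ((M.eval_flip_ne_zero_iff hcup hcap hd hd.length_eq).2 h₂)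
  · intro z hz hne
    rw [mem_words] at hz
    by_contra h
    have hcount' := M.count_of_eval_ne_zero hcup hc hc.length_eq (left_ne_zero_of_mul h)
    refine hne (List.eq_replicate_iff.2 ⟨hz, fun b hb => ?_⟩)
    exact ((List.count_eq_length.1 (by omega)) b hb).symm
  · simp [mem_words]

end Domain

end StringModel

/-! ### Counting two-colorings, which detects closed loops. -/

namespace Diagram

noncomputable instance fintypeArc : ∀ {m n : ℕ} (t : Diagram m n), Fintype (Arc t)
  | _, _, id n => inferInstanceAs (Fintype (Fin n))
  | _, _, cup => inferInstanceAs (Fintype Unit)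
  | _, _, cap => inferInstanceAs (Fintype Unit)
  | _, _, comp f g =>
    letI := fintypeArc f
    letI := fintypeArc g
    inferInstanceAs (Fintype (Arc f ⊕ Arc g))
  | _, _, tensor f g =>
    letI := fintypeArc f
    letI := fintypeArc g
    inferInstanceAs (Fintype (Arc f ⊕ Arc g))

/-- Colorings of the components of a diagram by two colors, with prescribed colors on the top and
bottom boundary. -/
def IsColoring {m n : ℕ} (t : Diagram m n) (c : Arc t → Bool) (x y : List Bool) : Prop :=
  (∀ a b, Joined t a b → c a = c b) ∧ List.ofFn (c ∘ topArc t) = x ∧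
    List.ofFn (c ∘ bottomArc t) = y

theorem isColoring_comp {l m n : ℕ} (f : Diagram m n) (g : Diagram l m) (c : Arc f → Bool)
    (c' : Arc g → Bool) (x y : List Bool) :
    IsColoring (comp f g) (Sum.elim c c') x y ↔
      IsColoring f c x (List.ofFn (c ∘ bottomArc f)) ∧
        IsColoring g c' (List.ofFn (c ∘ bottomArc f)) y := by
  constructor
  · rintro ⟨h, hx, hy⟩
    refine ⟨⟨fun a b hab => h (.inl a) (.inl b) hab, hx, rfl⟩,
      ⟨fun a b hab => h (.inr a) (.inr b) hab, ?_, hy⟩⟩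
    congr 1
    funext i
    exact (h (.inl (bottomArc f i)) (.inr (topArc g i)) ⟨i, rfl, rfl⟩).symm
  · rintro ⟨⟨h, hx, -⟩, ⟨h', he, hy⟩⟩
    refine ⟨?_, hx, hy⟩
    rintro (a | a) (b | b) hab
    · exact h a b hab
    · obtain ⟨i, rfl, rfl⟩ := hab
      exact (congrFun (List.ofFn_injective he) i).symm
    · exact hab.elim
    · exact h' a b hab

theorem ofFn_addCases {α : Type*} {m n : ℕ} (f : Fin m → α) (g : Fin n → α) :
    List.ofFn (fun i => Fin.addCases (motive := fun _ => α) f g i) =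
      List.ofFn f ++ List.ofFn g :=
  List.ofFn_fin_append f g

theorem isColoring_tensor {a b a' b' : ℕ} (f : Diagram a b) (g : Diagram a' b')
    (c : Arc f → Bool) (c' : Arc g → Bool) (x y : List Bool) :
    IsColoring (tensor f g) (Sum.elim c c') x y ↔
      IsColoring f c (x.take b) (y.take a) ∧ IsColoring g c' (x.drop b) (y.drop a) := by
  have aux : ∀ {p q : ℕ} (s : Fin p → Arc f) (s' : Fin q → Arc g) (z : List Bool),
      List.ofFn (Sum.elim c c' ∘ Fin.addCases (motive := fun _ => Arc f ⊕ Arc g)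
        (fun i => .inl (s i)) (fun i => .inr (s' i))) = z ↔
        List.ofFn (c ∘ s) = z.take p ∧ List.ofFn (c' ∘ s') = z.drop p := by
    intro p q s s' z
    have h : Sum.elim c c' ∘ Fin.addCases (motive := fun _ => Arc f ⊕ Arc g)
        (fun i => .inl (s i)) (fun i => .inr (s' i)) =
        fun i => Fin.addCases (motive := fun _ => Bool) (c ∘ s) (c' ∘ s') i := by
      funext i
      refine Fin.addCases (fun i => ?_) (fun i => ?_) i <;> simp
    rw [h, ofFn_addCases]
    constructor
    · rintro rfl
      simp
    · rintro ⟨h, h'⟩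
      rw [h, h', List.take_append_drop]
  have hx := aux (topArc f) (topArc g) x
  have hy := aux (bottomArc f) (bottomArc g) y
  constructor
  · rintro ⟨h, h₁, h₂⟩
    exact ⟨⟨fun a b hab => h (.inl a) (.inl b) hab, (hx.1 h₁).1, (hy.1 h₂).1⟩,
      ⟨fun a b hab => h (.inr a) (.inr b) hab, (hx.1 h₁).2, (hy.1 h₂).2⟩⟩
  · rintro ⟨⟨h, h₁, h₂⟩, ⟨h', h₁', h₂'⟩⟩
    refine ⟨?_, hx.2 ⟨h₁, h₁'⟩, hy.2 ⟨h₂, h₂'⟩⟩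
    rintro (a | a) (b | b) hab
    · exact h a b hab
    · exact hab.elim
    · exact hab.elim
    · exact h' a b hab

end Diagram

open Diagram

/-- The model that counts colorings of the components of a diagram by two colors. -/
def coloringModel : StringModel ℕ where
  χ := 1
  cup x y := if x = y then 1 else 0
  cap x y := if x = y then 1 else 0
  bubble := 2
  parity_cup := by simp
  parity_cap := by simp
  zigzag_left := by decide
  zigzag_right := by decide
  bubble_eq := by decide

namespace coloringModel

theorem sgn_eq : coloringModel.sgn = 1 := rfl

theorem sum_ite_of_iff {α : Type*} [Fintype α] {P : α → Prop} [DecidablePred P] {a : α}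
    {p : Prop} [Decidable p] (h : ∀ c, P c ↔ c = a ∧ p) :
    (∑ c, if P c then 1 else 0) = if p then 1 else 0 := by
  classical
  simp [h, ite_and]

theorem sum_sumArrow {α β γ M : Type*} [AddCommMonoid M] [Fintype (α → γ)] [Fintype (β → γ)]
    [Fintype (α ⊕ β → γ)] (F : (α ⊕ β → γ) → M) :
    ∑ c, F c = ∑ c, ∑ c', F (Sum.elim c c') := by
  rw [← Fintype.sum_prod_type' (f := fun c c' => F (Sum.elim c c'))]
  refine Fintype.sum_equiv (Equiv.sumArrowEquivProdArrow α β γ) _ _ fun c => ?_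
  exact congrArg F (Sum.elim_comp_inl_inr c).symm

open Classical in
theorem sum_isColoring_comp {l m n : ℕ} (f : Diagram m n) (g : Diagram l m) (x y : List Bool) :
    (∑ c, if IsColoring (.comp f g) c x y then 1 else 0) = ∑ c : Arc f → Bool,
      ∑ c' : Arc g → Bool, if IsColoring (.comp f g) (Sum.elim c c') x y then 1 else 0 := by
  let I : Fintype (Arc f ⊕ Arc g → Bool) := (inferInstance : Fintype (Arc (.comp f g) → Bool))
  have h := @sum_sumArrow (Arc f) (Arc g) Bool ℕ _ _ _ I
    (fun c => if IsColoring (.comp f g) c x y then 1 else 0)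
  exact h

open Classical in
theorem sum_isColoring_tensor {a b a' b' : ℕ} (f : Diagram a b) (g : Diagram a' b')
    (x y : List Bool) :
    (∑ c, if IsColoring (.tensor f g) c x y then 1 else 0) = ∑ c : Arc f → Bool,
      ∑ c' : Arc g → Bool, if IsColoring (.tensor f g) (Sum.elim c c') x y then 1 else 0 := by
  let I : Fintype (Arc f ⊕ Arc g → Bool) := (inferInstance : Fintype (Arc (.tensor f g) → Bool))
  have h := @sum_sumArrow (Arc f) (Arc g) Bool ℕ _ _ _ I
    (fun c => if IsColoring (.tensor f g) c x y then 1 else 0)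
  exact h

open Classical in
theorem eval_eq_sum {m n : ℕ} (t : Diagram m n) : ∀ {x y : List Bool}, x.length = n →
    y.length = m → coloringModel.eval t x y = ∑ c, if IsColoring t c x y then 1 else 0 := by
  induction t with
  | id n =>
    intro x y hx hy
    subst hx
    have h : ∀ c : Arc (.id x.length) → Bool,
        IsColoring (.id x.length) c x y ↔ c = x.get ∧ x = y := by
      intro c
      have hc : List.ofFn c = x ↔ c = x.get := by
        conv_lhs => rhs; rw [← List.ofFn_get x]
        exact List.ofFn_injective.eq_iff
      constructor
      · rintro ⟨-, h, h'⟩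
        exact ⟨hc.1 h, h.symm.trans h'⟩
      · rintro ⟨h, rfl⟩
        exact ⟨fun _ _ h => h.elim, hc.2 h, hc.2 h⟩
    exact (sum_ite_of_iff h).symm
  | cup =>
    intro x y hx hy
    obtain ⟨a, b, rfl⟩ := List.length_eq_two.1 hx
    obtain rfl := List.length_eq_zero_iff.1 hy
    have h : ∀ c : Arc .cup → Bool, IsColoring .cup c [a, b] [] ↔ c = (fun _ => a) ∧ a = b := by
      intro c
      constructor
      · rintro ⟨-, h, -⟩
        simp only [List.ofFn_succ, List.ofFn_zero, List.cons.injEq] at h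
        exact ⟨funext fun _ => h.1, h.1.symm.trans h.2.1⟩
      · rintro ⟨rfl, rfl⟩
        exact ⟨fun _ _ h => h.elim, rfl, rfl⟩
    exact (sum_ite_of_iff h).symm
  | cap =>
    intro x y hx hy
    obtain ⟨a, b, rfl⟩ := List.length_eq_two.1 hy
    obtain rfl := List.length_eq_zero_iff.1 hx
    have h : ∀ c : Arc .cap → Bool, IsColoring .cap c [] [a, b] ↔ c = (fun _ => a) ∧ a = b := by
      intro c
      constructor
      · rintro ⟨-, -, h⟩
        simp only [List.ofFn_succ, List.ofFn_zero, List.cons.injEq] at h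
        exact ⟨funext fun _ => h.1, h.1.symm.trans h.2.1⟩
      · rintro ⟨rfl, rfl⟩
        exact ⟨fun _ _ h => h.elim, rfl, rfl⟩
    exact (sum_ite_of_iff h).symm
  | comp f g hf hg =>
    intro x y hx hy
    rw [StringModel.eval_comp, sum_isColoring_comp]
    simp only [isColoring_comp]
    rw [Finset.sum_congr rfl fun z hz => by
      rw [hf hx (mem_words.1 hz), hg (mem_words.1 hz) hy, Finset.sum_mul_sum], Finset.sum_comm]
    refine Finset.sum_congr rfl fun c _ => ?_
    rw [Finset.sum_comm]
    refine Finset.sum_congr rfl fun c' _ => ?_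
    -- A coloring of `f` already determines the middle word, so the sum over middle words has one
    -- term.
    rw [Finset.sum_eq_single (List.ofFn (c ∘ bottomArc f))]
    · rw [ite_and]; split_ifs <;> simp
    · intro z _ hne
      rw [if_neg (fun h => hne h.2.2.symm), zero_mul]
    · simp [mem_words]
  | tensor f g hf hg =>
    intro x y hx hy
    rw [StringModel.eval_tensor, sum_isColoring_tensor]
    simp only [isColoring_tensor, sgn_eq, one_pow, one_mul]
    rw [hf (by simp [hx]) (by simp [hy]), hg (by simp [hx]) (by simp [hy]), Finset.sum_mul_sum]
    refine Finset.sum_congr rfl fun c _ => Finset.sum_congr rfl fun c' _ => ?_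
    rw [ite_and]; split_ifs <;> simp

open Classical in
-- With all boundary points `false`, components that reach the boundary are forced to be `false`,
-- whereas each closed loop may be colored freely. So the coloring is unique exactly when there are
-- no loops.
theorem isCrossinglessMatching_iff {m n : ℕ} (t : Diagram m n) : IsCrossinglessMatching t ↔
    coloringModel.eval t (List.replicate n false) (List.replicate m false) = 1 := by
  have hcol : ∀ c, IsColoring t c (List.replicate n false) (List.replicate m false) ↔
      (∀ a b, Relation.EqvGen (Joined t) a b → c a = c b) ∧ (∀ i, c (topArc t i) = false) ∧
        ∀ i, c (bottomArc t i) = false := by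
    intro c
    refine and_congr ⟨fun h a b hab => ?_, fun h a b hab => h a b (.rel _ _ hab)⟩ ?_
    · induction hab with
      | rel a b h' => exact h a b h'
      | refl => rfl
      | symm _ _ _ ih => exact ih.symm
      | trans _ _ _ _ _ ih ih' => exact ih.trans ih'
    · rw [← List.ofFn_const, ← List.ofFn_const, List.ofFn_inj, List.ofFn_inj, funext_iff,
        funext_iff]
      rfl
  rw [eval_eq_sum t (by simp) (by simp), Finset.sum_boole, Nat.cast_id,
    Finset.card_eq_one]
  constructor
  · intro h
    refine ⟨fun _ => false, ?_⟩
    ext c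
    simp only [Finset.mem_filter, Finset.mem_univ, true_and, Finset.mem_singleton, hcol]
    constructor
    · rintro ⟨h₁, h₂, h₃⟩
      funext a
      rcases h a with ⟨i, hi⟩ | ⟨i, hi⟩
      · rw [h₁ _ _ hi, h₃]
      · rw [h₁ _ _ hi, h₂]
    · rintro rfl
      simp
  · rintro ⟨c₀, h⟩ a
    have hall : ∀ c, IsColoring t c (List.replicate n false) (List.replicate m false) →
        c = c₀ := by
      intro c hc
      rw [← Finset.mem_singleton, ← h]
      simpa using hc
    by_contra hne
    push Not at hne
    have h₁ := hall (fun _ => false) ((hcol _).2 (by simp))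
    -- The component of `a`, which avoids the boundary, is colored `true` and all else `false`: a
    -- second coloring.
    have h₂ := hall (fun b => decide (Relation.EqvGen (Joined t) a b)) ((hcol _).2 (by
      refine ⟨fun b c hbc => ?_, by simpa using hne.2, by simpa using hne.1⟩
      rw [decide_eq_decide]
      exact ⟨fun h => h.trans _ _ _ hbc, fun h => h.trans _ _ _ hbc.symm⟩))
    have := congrFun (h₁.trans h₂.symm) a
    simp [Relation.EqvGen.refl] at this

theorem eval_flip {m n : ℕ} (t : Diagram m n) (x y : List Bool) :
    coloringModel.eval t.flip y x = coloringModel.eval t x y := by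
  induction t generalizing x y with
  | id => simp [Diagram.flip, StringModel.eval_id, eq_comm]
  | cup => rfl
  | cap => rfl
  | comp f g hf hg =>
    rw [Diagram.flip, StringModel.eval_comp, StringModel.eval_comp]
    exact Finset.sum_congr rfl fun z _ => by rw [hf, hg, mul_comm]
  | tensor f g hf hg =>
    rw [Diagram.flip, StringModel.eval_tensor, StringModel.eval_tensor]
    simp [sgn_eq, hf, hg]

/-- A composite of cups has no loops: an all-`false` top boundary forces every cup and every through
strand to be `false`. -/
theorem eval_normalCups {p n k : ℕ} {u : List Bool} {d : Diagram p n}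
    (hd : NormalCups p k u d) (y : List Bool) :
    coloringModel.eval d (List.replicate n false) y =
      if List.replicate p false = y then 1 else 0 := by
  induction hd with
  | id => rfl
  | @step n k u d a b h hk hd ih =>
    have e : List.replicate (a + 2 + b) false =
        List.replicate a false ++ false :: false :: List.replicate b false := by
      rw [List.replicate_add, List.replicate_add]; simp [List.replicate]
    rw [e, StringModel.eval_hcomp_cupAt _ d h (by simp) (by simp), ← List.replicate_add, ← h, ih,
      sgn_eq, one_pow, one_mul]
    exact one_mul _

theorem eval_comp_flip {p m n k l : ℕ} {u v : List Bool} {c : Diagram p n} {d : Diagram p m}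
    (hc : NormalCups p k u c) (hd : NormalCups p l v d) :
    coloringModel.eval (comp c d.flip) (List.replicate n false) (List.replicate m false) = 1 := by
  simp only [StringModel.eval_comp, eval_flip, eval_normalCups hc, eval_normalCups hd]
  simp [mem_words]

end coloringModel

/-! ### The super model and its matrix entries as linear forms on morphisms. -/

open Diagram

/-- The model on a superspace of dimension `(1|1)`. -/
noncomputable def superModel {k : Type*} [Field k] (q : k) (hq : q ≠ 0) : StringModel k where
  χ := (Int.castRingHom k : ℤ →* k).comp (Units.coeHom ℤ)
  -- The products of the cup and cap entries at `(true, false)` and `(false, true)` are `q⁻¹` and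
  -- `-q`, which add up to the bubble value; the crosswise products `1` and `-1` give the zigzags.
  cup x y := if x = y then 0 else if x then q⁻¹ else -1
  cap x y := if x = y then 0 else if x then 1 else q
  bubble := -(q - q⁻¹)
  parity_cup x y := by cases x <;> cases y <;> simp [oddCount]
  parity_cap x y := by cases x <;> cases y <;> simp [oddCount]
  zigzag_left x y := by cases x <;> cases y <;> simp [oddCount, hq]
  zigzag_right x y := by cases x <;> cases y <;> simp [oddCount, hq]
  bubble_eq := by simp; ring

namespace StringModel

variable {k : Type w} [Field k] (M : StringModel k)

theorem rel_scales (hχ : ∀ e : ℤˣ, M.χ e = ((e : ℤ) : k)) {c : k} {m n : ℕ}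
    {t t' : Diagram m n} (h : STL.Rel M.bubble t c t') : M.Scales t c t' := by
  induction h with
  | @move m n t t' e h =>
    intro x y hx hy
    rw [M.eval_move h hx hy, hχ]
  | bubble => exact fun x y hx hy => M.eval_bubble hx hy
  | comp_left g _ ih => simpa using ih.comp M (Scales.refl M g)
  | comp_right f _ ih => simpa using (Scales.refl M f).comp M ih
  | tensor_left g _ ih => simpa using ih.tensor M (Scales.refl M g) rfl
  | tensor_right f h ih => exact by simpa using (Scales.refl M f).tensor M ih (STL.degree_rel h)

/-- A matrix entry of a diagram, as a linear form on morphisms. -/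
noncomputable def entry (hχ : ∀ e : ℤˣ, M.χ e = ((e : ℤ) : k)) {m n : ℕ} {x y : List Bool}
    (hx : x.length = n) (hy : y.length = m) : STL.Hom M.bubble m n →ₗ[k] k :=
  STL.lift (fun t => M.eval t x y) fun _ _ _ h => M.rel_scales hχ h x y hx hy

theorem entry_ofDiagram (hχ : ∀ e : ℤˣ, M.χ e = ((e : ℤ) : k)) {m n : ℕ} {x y : List Bool}
    (hx : x.length = n) (hy : y.length = m) (t : Diagram m n) :
    M.entry hχ hx hy (STL.ofDiagram M.bubble t) = M.eval t x y := by
  simp [entry]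

end StringModel

/-! ### Normal diagrams and crossingless matchings. -/

namespace Diagram

/-- A composite of a normal sequence of caps followed by a normal sequence of cups. -/
def IsNormal {m n : ℕ} (t : Diagram m n) : Prop :=
  ∃ (p k l : ℕ) (u v : List Bool) (c : Diagram p n) (d : Diagram p m),
    NormalCups p k u c ∧ NormalCups p l v d ∧ t = comp c d.flip

theorem exists_isNormal {m n : ℕ} (t : Diagram m n) :
    ∃ (j : ℕ) (t' : Diagram m n), IsNormal t' ∧ Reduces j t t' := by
  obtain ⟨j, p, m', n', c, d, hc, hd, h⟩ := reducesToCapsCups t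
  obtain ⟨rfl, rfl, h⟩ := h
  obtain ⟨k, u, c', hc', hi⟩ := hc.exists_normalCups
  obtain ⟨l, v, d', hd', hi'⟩ := hd.exists_normalCups
  exact ⟨j, comp c' d'.flip, ⟨p, k, l, u, v, c', d', hc', hd', rfl⟩,
    ((HReduces.of_reduces h).trans_hisotopic (hi.comp hi'.flip)).reduces⟩

theorem IsNormal.eval_coloringModel {m n : ℕ} {t : Diagram m n} (ht : IsNormal t) :
    coloringModel.eval t (List.replicate n false) (List.replicate m false) = 1 := by
  obtain ⟨p, k, l, u, v, c, d, hc, hd, rfl⟩ := ht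
  exact coloringModel.eval_comp_flip hc hd

theorem IsNormal.isCrossinglessMatching {m n : ℕ} {t : Diagram m n} (ht : IsNormal t) :
    IsCrossinglessMatching t :=
  (coloringModel.isCrossinglessMatching_iff t).2 ht.eval_coloringModel

theorem IsCrossinglessMatching.exists_isNormal {m n : ℕ} {t : Diagram m n}
    (ht : IsCrossinglessMatching t) : ∃ t' : Diagram m n, IsNormal t' ∧ Isotopic t t' := by
  obtain ⟨j, t', ht', h⟩ := Diagram.exists_isNormal t
  refine ⟨t', ht', h.isotopic_of_eq_zero ?_⟩
  obtain ⟨-, e, hs⟩ := coloringModel.reduces_scales h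
  have := hs (List.replicate n false) (List.replicate m false) (by simp) (by simp)
  rw [(coloringModel.isCrossinglessMatching_iff t).1 ht, ht'.eval_coloringModel, mul_one] at this
  by_contra hj
  -- In the coloring model signs act trivially and a circle counts `2`; as both diagrams have count
  -- `1`, no circle was removed.
  have h₂ : (1 : ℕ) = 1 * 2 ^ j := this
  have h₃ := Nat.one_lt_two_pow hj
  omega

end Diagram

/-! ### Isotopy and removal of circles as scalars in `STL(δ)`. -/

namespace STL

variable {k : Type w} [Field k]

theorem ofDiagram_isotopic (δ : k) {m n : ℕ} {t t' : Diagram m n} (h : Isotopic t t') :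
    ∃ e : ℤˣ, ofDiagram δ t = ((e : ℤ) : k) • ofDiagram δ t' := by
  induction h with
  | refl t => exact ⟨1, by simp⟩
  | symm _ h =>
    obtain ⟨e, h⟩ := h
    refine ⟨e, ?_⟩
    rw [h, smul_smul, ← Int.cast_mul, ← Units.val_mul, Int.units_mul_self]
    simp
  | trans _ _ h h' =>
    obtain ⟨e, h⟩ := h
    obtain ⟨e', h'⟩ := h'
    exact ⟨e * e', by rw [h, h', smul_smul]; simp⟩
  | move e h => exact ⟨e, ofDiagram_rel (.move h)⟩
  | comp _ _ h h' =>
    obtain ⟨e, h⟩ := h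
    obtain ⟨e', h'⟩ := h'
    exact ⟨e * e', by
      rw [← comp_ofDiagram, h, h', map_smul, LinearMap.map_smul₂, smul_smul, mul_comm,
        comp_ofDiagram]; simp⟩
  | tensor _ _ h h' =>
    obtain ⟨e, h⟩ := h
    obtain ⟨e', h'⟩ := h'
    exact ⟨e * e', by
      rw [← tensor_ofDiagram, h, h', map_smul, LinearMap.map_smul₂, smul_smul, mul_comm,
        tensor_ofDiagram]; simp⟩

theorem ofDiagram_reduces (δ : k) {j m n : ℕ} {t t' : Diagram m n} (h : Reduces j t t') :
    ∃ c : k, ofDiagram δ t = c • ofDiagram δ t' := by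
  induction h with
  | isotopic h =>
    obtain ⟨e, h⟩ := ofDiagram_isotopic δ h
    exact ⟨_, h⟩
  | bubble => exact ⟨δ, ofDiagram_rel .bubble⟩
  | trans _ _ h h' =>
    obtain ⟨e, h⟩ := h
    obtain ⟨e', h'⟩ := h'
    exact ⟨e * e', by rw [h, h', smul_smul]⟩
  | comp _ _ h h' =>
    obtain ⟨e, h⟩ := h
    obtain ⟨e', h'⟩ := h'
    exact ⟨e * e', by
      rw [← comp_ofDiagram, h, h', map_smul, LinearMap.map_smul₂, smul_smul, mul_comm,
        comp_ofDiagram]⟩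
  | tensor _ _ h h' =>
    obtain ⟨e, h⟩ := h
    obtain ⟨e', h'⟩ := h'
    exact ⟨e * e', by
      rw [← tensor_ofDiagram, h, h', map_smul, LinearMap.map_smul₂, smul_smul, mul_comm,
        tensor_ofDiagram]⟩

end STL

/-! ### Linear independence of normal diagrams and the basis theorem. -/

/-- In a linear relation, the form `φ j` attached to an index `j` of least key with nonzero
coefficient sees only the term of `j`. -/
theorem linearIndependent_of_triangular {ι k V α : Type*} [Field k] [AddCommGroup V] [Module k V]
    [LinearOrder α] {v : ι → V} (key : ι → α) (φ : ι → V →ₗ[k] k) (h : ∀ i, φ i (v i) ≠ 0)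
    (h' : ∀ i j, i ≠ j → φ j (v i) ≠ 0 → key i < key j) : LinearIndependent k v := by
  classical
  rw [linearIndependent_iff']
  intro s g hs i hi
  by_contra hne
  obtain ⟨j, hj, hmin⟩ := (s.filter (g · ≠ 0)).exists_min_image key
    ⟨i, by simp [hi, hne]⟩
  rw [Finset.mem_filter] at hj
  have := congrArg (φ j) hs
  rw [map_sum, map_zero, Finset.sum_eq_single j, map_smul, smul_eq_mul] at this
  · exact mul_ne_zero hj.2 (h j) this
  · intro i hi hij
    by_contra hne
    rw [map_smul, smul_eq_mul] at hne
    exact (hmin i (by simp [hi, left_ne_zero_of_mul hne])).not_gt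
      (h' i j hij (right_ne_zero_of_mul hne))
  · exact fun h => absurd hj.1 h

theorem linearIndependent_isNormal {k : Type w} [Field k] (q : k) (hq : q ≠ 0) (m n : ℕ) :
    LinearIndependent k fun t : {t : Diagram m n // IsNormal t} =>
      STL.ofDiagram (-(q - q⁻¹)) t.1 := by
  let M := superModel q hq
  have hχ : ∀ e : ℤˣ, M.χ e = ((e : ℤ) : k) := fun _ => rfl
  have hcup : ∀ r s, M.cup r s ≠ 0 ↔ r ≠ s := by
    intro r s; cases r <;> cases s <;> simp [M, superModel, hq]
  have hcap : ∀ r s, M.cap r s ≠ 0 ↔ r ≠ s := by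
    intro r s; cases r <;> cases s <;> simp [M, superModel, hq]
  choose p k₁ k₂ u v c d hc hd ht using fun t : {t : Diagram m n // IsNormal t} => t.2
  -- More through strands come first, since a nonzero entry at the words of `j` needs at least as
  -- many through strands as `j` has. For equal numbers both binary values are bounded by those of
  -- `j`, so their sum is strictly smaller unless both words, and hence the diagrams, coincide.
  let key : {t : Diagram m n // IsNormal t} → ℕᵒᵈ ×ₗ ℕ := fun t =>
    toLex (OrderDual.toDual (p t),
      StringModel.binaryValue (u t) + StringModel.binaryValue (v t))
  have hent : ∀ i j, M.entry hχ (hc j).length_eq (hd j).length_eq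
      (STL.ofDiagram M.bubble i.1) = M.eval (comp (c i) (d i).flip) (u j) (v j) := by
    intro i j
    rw [StringModel.entry_ofDiagram, ← ht i]
  refine linearIndependent_of_triangular key
    (fun j => M.entry hχ (hc j).length_eq (hd j).length_eq) (fun j => ?_) fun i j hij hne => ?_
  · exact fun h => (M.eval_comp_flip_ne_zero hcup hcap (hc j) (hd j)).2 ((hent j j).symm.trans h)
  · replace hne : M.eval (comp (c i) (d i).flip) (u j) (v j) ≠ 0 :=
      fun h => hne ((hent i j).trans h)
    obtain ⟨hle, hval⟩ := M.exists_of_eval_comp_ne_zero hcup hcap (hc i) (hd i) (hc j).length_eq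
      (hd j).length_eq (M.eval_comp_flip_ne_zero hcup hcap (hc j) (hd j)).1 hne
    rw [Prod.Lex.lt_iff]
    rcases hle.lt_or_eq with hlt | heq
    · exact .inl (OrderDual.toDual_lt_toDual.2 hlt)
    · obtain ⟨hu, hv⟩ := hval heq
      refine .inr ⟨congrArg OrderDual.toDual heq.symm, ?_⟩
      by_contra hge
      change ¬ _ + _ < _ + _ at hge
      refine hij (Subtype.ext ?_)
      have hu' := StringModel.eq_of_binaryValue_eq
        ((hc i).length_eq.trans (hc j).length_eq.symm) (by omega)
      have hv' := StringModel.eq_of_binaryValue_eq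
        ((hd i).length_eq.trans (hd j).length_eq.symm) (by omega)
      have aux : ∀ {p p' k k' l l' : ℕ} {u u' v v' : List Bool} {c : Diagram p n}
          {c' : Diagram p' n} {d : Diagram p m} {d' : Diagram p' m}, NormalCups p k u c →
          NormalCups p' k' u' c' → NormalCups p l v d → NormalCups p' l' v' d' → p' = p →
          u = u' → v = v' → comp c d.flip = comp c' d'.flip := by
        intro p p' k k' l l' u u' v v' c c' d d' hc hc' hd hd' hp hu hv
        subst hp
        obtain ⟨h₁, rfl⟩ := hc.unique hc' hu
        obtain ⟨h₂, rfl⟩ := hd.unique hd' hv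
        rfl
      rw [ht i, ht j]
      exact aux (hc i) (hc j) (hd i) (hd j) heq hu' hv'

theorem mainTheorem4 {k : Type*} [Field k] (hk : ringChar k ≠ 2) (q : k) (hq : q ≠ 0)
    (hroot : ∀ r : ℕ, 0 < r → q ^ r ≠ 1) (δ : k) (hδ : δ = -(q - q⁻¹)) (m n : ℕ)
    (S : Set (Diagram m n)) (hS : Diagram.IsSetOfRepresentatives S) :
    ∃ b : Module.Basis S k ((oddTemperleyLieb δ).Hom m n),
      ∀ s : S, b s = oddTemperleyLieb.ofDiagram δ (s : Diagram m n) := by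
  subst hδ
  obtain ⟨hS, hrep⟩ := hS
  choose N hN hiso using fun s : S => (hS s.1 s.2).exists_isNormal
  -- Representatives with the same normal form are isotopic, hence equal by uniqueness of
  -- representatives.
  have hinj : Function.Injective fun s : S => (⟨N s, hN s⟩ : {t : Diagram m n // IsNormal t}) := by
    intro s s' h
    have h' : N s = N s' := congrArg Subtype.val h
    have hs := (hiso s).trans (h' ▸ (hiso s').symm)
    exact Subtype.ext ((hrep s.1 (hS s.1 s.2)).unique ⟨s.2, .refl _⟩ ⟨s'.2, hs⟩)
  choose e he using fun s : S => STL.ofDiagram_isotopic (-(q - q⁻¹)) (hiso s)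
  have hli : LinearIndependent k fun s : S => STL.ofDiagram (-(q - q⁻¹)) s.1 := by
    -- Each representative is a unit `±1` times its normal form, and rescaling by units preserves
    -- independence.
    have h := ((linearIndependent_isNormal q hq m n).comp _ hinj).units_smul
      (fun s => Units.map (Int.castRingHom k : ℤ →* k) (e s))
    convert h using 1
    funext s
    exact he s
  have hspan : ⊤ ≤ Submodule.span k (Set.range fun s : S => STL.ofDiagram (-(q - q⁻¹)) s.1) := by
    intro x _
    induction x using STL.induction with
    | of t =>
      obtain ⟨j, t', ht', h⟩ := Diagram.exists_isNormal t
      obtain ⟨a, ha⟩ := STL.ofDiagram_reduces (-(q - q⁻¹)) h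
      -- The normal form of `t` is itself a crossingless matching, even if `t` has loops, so some
      -- member of `S` represents it.
      obtain ⟨s, ⟨hs, hi⟩, -⟩ := hrep t' ht'.isCrossinglessMatching
      obtain ⟨b, hb⟩ := STL.ofDiagram_isotopic (-(q - q⁻¹)) hi
      rw [ha, hb]
      exact Submodule.smul_mem _ _ (Submodule.smul_mem _ _
        (Submodule.subset_span ⟨⟨s, hs⟩, rfl⟩))
    | zero => exact Submodule.zero_mem _
    | add x y hx hy => exact Submodule.add_mem _ (hx trivial) (hy trivial)
    | smul c x hx => exact Submodule.smul_mem _ _ (hx trivial)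
  exact ⟨Module.Basis.mk hli hspan, fun s => Module.Basis.mk_apply _ _ _⟩
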